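/- Let $d\ge 1$ and $\alpha>d$, and let $(\xi(z))_{z\in\mathbb Z^d}$ be independent random variables with $\mathrm{Prob}(\xi(z)\le x)=1-x^{-\alpha}$ for $x\ge 1$. Write $|x|$ for the $\ell^1$-norm on $\mathbb R^d$ and put $$q=\frac{d}{\alpha-d},\qquad \mu=\frac{(\alpha-d)^d\,2^d\,B(\alpha-d,d)}{d^d\,(d-1)!},$$ where $B$ is the Beta function. For $t>0$ and $z\in\mathbb Z^d$ let $$\Psi_t(z)=\xi(z)-\frac{|z|}{t}\log\frac{|z|}{2det},\qquad \Psi_t(0)=\xi(0),$$ where $2det=2\cdot d\cdot e\cdot t$. For every $t>0$, almost surely $\Psi_t$ attains its maximum over $\mathbb Z^d$ at exactly one point; let $Z_t$ be a $\mathbb Z^d$-valued map that almost surely equals this point. Then, as $t\to\infty$, $$Z_t\Big(\frac{\log t}{t}\Big)^{q+1}\Longrightarrow X$$ weakly, where $X$ is an $\mathbb R^d$-valued random variable with Lebesgue probability density $$p(x)=\alpha\int_0^\infty\frac{\exp\{-\mu y^{d-\alpha}\}}{(y+q|x|)^{\alpha+1}}\,dy .$$ Moreover, jointly, $$\Big(Z_t\Big(\frac{\log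 t}{t}\Big)^{q+1},\ \Big(\frac{\log t}{t}\Big)^{q}\,\Psi_t(Z_t)\Big)\Longrightarrow (X,Y),$$ where $(X,Y)$ has Lebesgue probability density $\alpha\exp\{-\mu y^{d-\alpha}\}/(y+q|x|)^{\alpha+1}$ on $\mathbb R^d\times(0,\infty)$; in particular $\mathrm{Prob}(Y\le y)=\exp\{-\mu y^{d-\alpha}\}$ for $y>0$. -/

import Mathlib

open MeasureTheory ProbabilityTheory Filter Topology

noncomputable section

namespace ParabolicAnderson

/-- The `ℓ¹`-norm `|x|` on `ℝ^d`. -/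
def l1norm {d : ℕ} (x : Fin d → ℝ) : ℝ := ∑ i, |x i|

/-- The inclusion of the lattice `ℤ^d` in `ℝ^d`. -/
def toReal {d : ℕ} (z : Fin d → ℤ) : Fin d → ℝ := fun i => (z i : ℝ)

/-- `q = d / (α - d)`. -/
def q (d : ℕ) (α : ℝ) : ℝ := d / (α - d)

/-- `μ = (α - d)^d 2^d B(α - d, d) / (d^d (d - 1)!)`, where `B` is the Beta function. -/
def mu (d : ℕ) (α : ℝ) : ℝ :=
  (α - d) ^ d * 2 ^ d * ProbabilityTheory.beta (α - d) d / ((d : ℝ) ^ d * (Nat.factorial (d - 1)))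

/-- `Ψ_t(z) = ξ(z) - (|z| / t) log (|z| / (2 d e t))`, for a potential `ξ : ℤ^d → ℝ`.
At `z = 0` this is `ξ(0)`, since the factor `|z|` vanishes there. -/
def Psi {d : ℕ} (ξ : (Fin d → ℤ) → ℝ) (t : ℝ) (z : Fin d → ℤ) : ℝ :=
  ξ z - l1norm (toReal z) / t * Real.log (l1norm (toReal z) / (2 * d * Real.exp 1 * t))

/-- `z` is a point at which `Ψ_t` attains its maximum over `ℤ^d`. -/
def IsMaximiser {d : ℕ} (ξ : (Fin d → ℤ) → ℝ) (t : ℝ) (z : Fin d → ℤ) : Prop :=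
  ∀ z', Psi ξ t z' ≤ Psi ξ t z

/-- `α exp(-μ y^(d - α)) / (y + q |x|)^(α + 1)`, to be used for `y > 0`. -/
def kernelDensity (d : ℕ) (α : ℝ) (x : Fin d → ℝ) (y : ℝ) : ℝ :=
  α * (Real.exp (-(mu d α * y ^ ((d : ℝ) - α))) / (y + q d α * l1norm x) ^ (α + 1))

/-- The density `p(x) = α ∫₀^∞ exp(-μ y^(d - α)) / (y + q |x|)^(α + 1) dy`. -/
def p (d : ℕ) (α : ℝ) (x : Fin d → ℝ) : ℝ :=
  α * ∫ y in Set.Ioi (0 : ℝ),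
    Real.exp (-(mu d α * y ^ ((d : ℝ) - α))) / (y + q d α * l1norm x) ^ (α + 1)

/-- The measure on `ℝ^d` with Lebesgue density `p`. -/
def limitLaw (d : ℕ) (α : ℝ) : Measure (Fin d → ℝ) :=
  volume.withDensity fun x => ENNReal.ofReal (p d α x)

/-- The measure on `ℝ^d × ℝ` with Lebesgue density
`(x, y) ↦ α exp(-μ y^(d - α)) / (y + q |x|)^(α + 1)` on `y > 0` and `0` on `y ≤ 0`. -/
def jointLimitLaw (d : ℕ) (α : ℝ) : Measure ((Fin d → ℝ) × ℝ) :=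
  volume.withDensity fun v =>
    if 0 < v.2 then ENNReal.ofReal (kernelDensity d α v.1 v.2) else 0

end ParabolicAnderson

end

noncomputable section

namespace ParabolicAnderson

open scoped ENNReal

/-! Write s = log t / t. The maximiser lives at distance s^(-(q+1)) and the maximum has size s^(-q).
At distances of this order log(|z|/(2det)) is asymptotic to q log t, so in rescaled units the cost
at x tends to q|x|. A Pareto tail at height s^(-q) contributes s^(qα) per site, and there are
s^(-(q+1)d) sites per unit volume; these balance exactly because qα = (q+1)d. Heuristically the
rescaled points (x, Ψ) form a Poisson process with intensity α (y + q|x|)^(-(α+1)). Its mass above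
level y is ∫ (y + q|x|)^(-α) dx = μ y^(d-α), and the density of its top point is the intensity times
the void probability exp(-μ y^(d-α)).

The proof needs no Poisson convergence, no tightness and no upper bound. The candidate limit has
total mass 1 (`isProbabilityMeasure_jointLimitLaw`), so by the portmanteau theorem it is enough to
bound the liminf of the probability of every open set from below. Independence bounds the
probability that z is the maximiser, with a given value, by an integral of P(max ≤ u) against the
Pareto density. Spread over lattice cells (`lintegral_cellDensity_le`), these bounds become the
integral of one function on ℝ^d × ℝ. The liminf of this function dominates the limit density
pointwise (`le_liminf_cellDensity`), and Fatou's lemma finishes. The distribution function of the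
maximum enters through `tendsto_tsum_rpow_neg` and `exists_tendsto_le_maxCDF`. Existence of the
maximiser is a Borel–Cantelli argument; uniqueness holds because Pareto laws have no atoms. -/

lemma l1norm_nonneg {d : ℕ} (x : Fin d → ℝ) : 0 ≤ l1norm x :=
  Finset.sum_nonneg fun _ _ => abs_nonneg _

lemma continuous_l1norm {d : ℕ} : Continuous (l1norm : (Fin d → ℝ) → ℝ) := by
  unfold l1norm; fun_prop

@[fun_prop]
lemma measurable_l1norm {d : ℕ} : Measurable (l1norm : (Fin d → ℝ) → ℝ) :=
  continuous_l1norm.measurable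

lemma l1norm_smul {d : ℕ} (c : ℝ) (x : Fin d → ℝ) : l1norm (c • x) = |c| * l1norm x := by
  simp [l1norm, abs_mul, Finset.mul_sum]

/-! ### Integrals over ℝ^d of powers of y + c|x| -/

lemma integral_exp_neg_mul_abs {c : ℝ} (hc : 0 < c) :
    ∫ x : ℝ, Real.exp (-(c * |x|)) = 2 / c := by
  rw [integral_comp_abs (f := fun x => Real.exp (-(c * x)))]
  have := integral_exp_mul_Ioi (a := -c) (by linarith) 0
  simp only [neg_mul] at this
  rw [this]; simp; ring

lemma integrable_exp_neg_mul_abs {c : ℝ} (hc : 0 < c) :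
    Integrable (fun x : ℝ => Real.exp (-(c * |x|))) := by
  refine Integrable.of_integral_ne_zero ?_
  rw [integral_exp_neg_mul_abs hc]
  positivity

lemma lintegral_exp_neg_mul_l1norm (d : ℕ) {c : ℝ} (hc : 0 < c) :
    ∫⁻ x : Fin d → ℝ, ENNReal.ofReal (Real.exp (-(c * l1norm x))) =
      ENNReal.ofReal ((2 / c) ^ d) := by
  have h : ∀ x : Fin d → ℝ, Real.exp (-(c * l1norm x)) = ∏ i, Real.exp (-(c * |x i|)) := by
    intro x
    rw [← Real.exp_sum, l1norm, Finset.mul_sum, Finset.sum_neg_distrib]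
  simp_rw [h]
  rw [← ofReal_integral_eq_lintegral_ofReal]
  · rw [integral_fintype_prod_volume_eq_prod (f := fun _ x => Real.exp (-(c * |x|)))]
    simp only [integral_exp_neg_mul_abs hc, Finset.prod_const, Finset.card_univ, Fintype.card_fin]
  · exact Integrable.fintype_prod (f := fun _ x => Real.exp (-(c * |x|)))
      fun _ => integrable_exp_neg_mul_abs hc
  · exact ae_of_all _ fun x => Finset.prod_nonneg fun _ _ => (Real.exp_pos _).le

lemma lintegral_rpow_mul_exp_neg_mul {β y : ℝ} (hβ : 0 < β) (hy : 0 < y) :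
    ∫⁻ u in Set.Ioi (0 : ℝ), ENNReal.ofReal (u ^ (β - 1) * Real.exp (-(y * u))) =
      ENNReal.ofReal (y ^ (-β) * Real.Gamma β) := by
  have hi : IntegrableOn (fun u : ℝ => u ^ (β - 1) * Real.exp (-(y * u))) (Set.Ioi 0) := by
    have := integrableOn_rpow_mul_exp_neg_mul_rpow (s := β - 1) (p := 1) (by linarith) zero_lt_one hy
    simpa using this
  rw [← ofReal_integral_eq_lintegral_ofReal hi]
  · rw [Real.integral_rpow_mul_exp_neg_mul_Ioi hβ hy, one_div, Real.inv_rpow hy.le,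
      Real.rpow_neg hy.le]
  · filter_upwards [ae_restrict_mem measurableSet_Ioi] with u hu
    exact mul_nonneg (Real.rpow_nonneg (le_of_lt hu) _) (Real.exp_pos _).le

/-- The Gamma integral writes the power as a superposition of exp(-(y + c|x|)u) over u > 0. After
Tonelli the ℓ¹-exponential factorises over coordinates and contributes (2/(cu))^d, which leaves a
Gamma integral of index β - d. -/
lemma lintegral_add_mul_l1norm_rpow (d : ℕ) {β y c : ℝ} (hβ : (d : ℝ) < β) (hy : 0 < y)
    (hc : 0 < c) :
    ∫⁻ x : Fin d → ℝ, ENNReal.ofReal ((y + c * l1norm x) ^ (-β)) =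
      ENNReal.ofReal ((2 / c) ^ d * y ^ ((d : ℝ) - β) * Real.Gamma (β - d) / Real.Gamma β) := by
  have hβ0 : 0 < β := lt_of_le_of_lt (Nat.cast_nonneg d) hβ
  have hΓ := Real.Gamma_pos_of_pos hβ0
  have h1 : ∀ x : Fin d → ℝ, ENNReal.ofReal ((y + c * l1norm x) ^ (-β)) =
      ENNReal.ofReal (Real.Gamma β)⁻¹ * ∫⁻ u in Set.Ioi (0 : ℝ),
        ENNReal.ofReal (u ^ (β - 1) * Real.exp (-((y + c * l1norm x) * u))) := by
    intro x
    have hp : 0 < y + c * l1norm x := by have := l1norm_nonneg x; positivity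
    rw [lintegral_rpow_mul_exp_neg_mul hβ0 hp, ← ENNReal.ofReal_mul (by positivity)]
    congr 1; field_simp
  simp_rw [h1]
  rw [lintegral_const_mul' _ _ ENNReal.ofReal_ne_top,
    lintegral_lintegral_swap (by
      apply Measurable.aemeasurable; fun_prop)]
  have h2 : ∀ u ∈ Set.Ioi (0 : ℝ), ∫⁻ x : Fin d → ℝ,
      ENNReal.ofReal (u ^ (β - 1) * Real.exp (-((y + c * l1norm x) * u))) =
      ENNReal.ofReal ((2 / c) ^ d) *
        ENNReal.ofReal (u ^ ((β - d) - 1) * Real.exp (-(y * u))) := by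
    intro u hu
    have hu : 0 < u := hu
    have : ∀ x : Fin d → ℝ, ENNReal.ofReal (u ^ (β - 1) * Real.exp (-((y + c * l1norm x) * u))) =
        ENNReal.ofReal (u ^ (β - 1) * Real.exp (-(y * u))) *
          ENNReal.ofReal (Real.exp (-((c * u) * l1norm x))) := by
      intro x
      rw [← ENNReal.ofReal_mul (by positivity), mul_assoc, ← Real.exp_add]
      congr 3; ring
    simp_rw [this]
    rw [lintegral_const_mul' _ _ ENNReal.ofReal_ne_top,
      lintegral_exp_neg_mul_l1norm d (by positivity), ← ENNReal.ofReal_mul (by positivity),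
      ← ENNReal.ofReal_mul (by positivity)]
    congr 1
    rw [show β - d - 1 = (β - 1) - d by ring, Real.rpow_sub hu (β - 1) d, Real.rpow_natCast,
      show 2 / (c * u) = 2 / c / u by rw [div_div], div_pow (2 / c) u]
    field_simp
  rw [setLIntegral_congr_fun measurableSet_Ioi h2, lintegral_const_mul' _ _ ENNReal.ofReal_ne_top,
    lintegral_rpow_mul_exp_neg_mul (by linarith) hy, ← ENNReal.ofReal_mul (by positivity),
    ← ENNReal.ofReal_mul (by positivity)]
  congr 1
  rw [neg_sub]; field_simp

@[fun_prop]
lemma measurable_kernelDensity (d : ℕ) (α : ℝ) :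
    Measurable fun v : (Fin d → ℝ) × ℝ => kernelDensity d α v.1 v.2 := by
  unfold kernelDensity; fun_prop

lemma measurable_jointDensity (d : ℕ) (α : ℝ) :
    Measurable fun v : (Fin d → ℝ) × ℝ =>
      if 0 < v.2 then ENNReal.ofReal (kernelDensity d α v.1 v.2) else 0 :=
  Measurable.ite (measurableSet_lt measurable_const measurable_snd)
    (measurable_kernelDensity d α).ennreal_ofReal measurable_const

/-! ### Normalisation and marginals of the limit law -/

section Constants

variable {d : ℕ} {α : ℝ}

lemma q_pos (hd : 1 ≤ d) (hα : (d : ℝ) < α) : 0 < q d α := by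
  have : (0 : ℝ) < d := by exact_mod_cast hd
  exact div_pos this (by linarith)

/-- In B(α-d, d) = Γ(α-d)Γ(d)/Γ(α) the factor Γ(d) = (d-1)! cancels the factorial in the definition.
-/
lemma mu_eq (hd : 1 ≤ d) (hα : (d : ℝ) < α) :
    mu d α = (2 / q d α) ^ d * Real.Gamma (α - d) / Real.Gamma α := by
  have h0 : (0 : ℝ) < d := by exact_mod_cast hd
  obtain ⟨n, rfl⟩ : ∃ n, d = n + 1 := ⟨d - 1, by omega⟩
  have h2 : 0 < α - (n + 1 : ℕ) := by linarith
  rw [mu, q, ProbabilityTheory.beta, sub_add_cancel]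
  have : Real.Gamma ((n + 1 : ℕ) : ℝ) = Nat.factorial n := by
    push_cast; exact Real.Gamma_nat_eq_factorial n
  rw [this, Nat.add_sub_cancel, div_div_eq_mul_div, div_pow, mul_pow]
  have := Nat.factorial_pos n
  field_simp

lemma mu_pos (hd : 1 ≤ d) (hα : (d : ℝ) < α) : 0 < mu d α := by
  rw [mu_eq hd hα]
  have h0 : (0 : ℝ) < d := by exact_mod_cast hd
  have := q_pos hd hα
  have := Real.Gamma_pos_of_pos (sub_pos.2 hα)
  have := Real.Gamma_pos_of_pos (h0.trans hα)
  positivity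

lemma lintegral_rpow_neg_eq_mu (hd : 1 ≤ d) (hα : (d : ℝ) < α) {y : ℝ} (hy : 0 < y) :
    ∫⁻ x : Fin d → ℝ, ENNReal.ofReal ((y + q d α * l1norm x) ^ (-α)) =
      ENNReal.ofReal (mu d α * y ^ ((d : ℝ) - α)) := by
  rw [lintegral_add_mul_l1norm_rpow d hα hy (q_pos hd hα), mu_eq hd hα]
  congr 1; ring

/-- Integrating out x with exponent α + 1 produces Γ(α-d+1)/Γ(α+1), which differs from the constant
in μ by (α-d)/α. The result is therefore the exact y-derivative of exp(-μ y^(d-α)). -/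
lemma lintegral_kernelDensity (hd : 1 ≤ d) (hα : (d : ℝ) < α) {y : ℝ} (hy : 0 < y) :
    ∫⁻ x : Fin d → ℝ, ENNReal.ofReal (kernelDensity d α x y) =
      ENNReal.ofReal (Real.exp (-(mu d α * y ^ ((d : ℝ) - α))) *
        (mu d α * ((α - d) * y ^ ((d : ℝ) - α - 1)))) := by
  have h0 : (0 : ℝ) < d := by exact_mod_cast hd
  have hα0 := h0.trans hα
  have hq := q_pos hd hα
  have h : ∀ x : Fin d → ℝ, ENNReal.ofReal (kernelDensity d α x y) =
      ENNReal.ofReal (α * Real.exp (-(mu d α * y ^ ((d : ℝ) - α)))) *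
        ENNReal.ofReal ((y + q d α * l1norm x) ^ (-(α + 1))) := by
    intro x
    have hp : 0 < y + q d α * l1norm x := by have := l1norm_nonneg x; positivity
    rw [← ENNReal.ofReal_mul (by positivity), kernelDensity, Real.rpow_neg hp.le]
    congr 1; ring
  simp_rw [h]
  rw [lintegral_const_mul' _ _ ENNReal.ofReal_ne_top,
    lintegral_add_mul_l1norm_rpow d (by linarith) hy hq, ← ENNReal.ofReal_mul (by positivity),
    mu_eq hd hα]
  congr 1
  have := Real.Gamma_pos_of_pos hα0
  rw [show α + 1 - d = (α - d) + 1 by ring, Real.Gamma_add_one (by linarith),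
    Real.Gamma_add_one hα0.ne', show (d : ℝ) - (α + 1) = d - α - 1 by ring]
  field_simp

/-- The `y`-marginal density of the joint limit law. -/
lemma jointLimitLaw_snd_preimage (hd : 1 ≤ d) (hα : (d : ℝ) < α) {s : Set ℝ}
    (hs : MeasurableSet s) :
    jointLimitLaw d α {v | v.2 ∈ s} = ∫⁻ y in s ∩ Set.Ioi 0,
      ENNReal.ofReal (Real.exp (-(mu d α * y ^ ((d : ℝ) - α))) *
        (mu d α * ((α - d) * y ^ ((d : ℝ) - α - 1)))) := by
  have hm := measurable_jointDensity d α
  have hS : MeasurableSet {v : (Fin d → ℝ) × ℝ | v.2 ∈ s} := measurable_snd hs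
  rw [jointLimitLaw, withDensity_apply _ hS, ← lintegral_indicator hS, Measure.volume_eq_prod,
    lintegral_prod_symm _ (hm.indicator hS).aemeasurable,
    ← lintegral_indicator (hs.inter measurableSet_Ioi)]
  refine lintegral_congr fun y => ?_
  by_cases hy : y ∈ s ∩ Set.Ioi 0
  · rw [Set.indicator_of_mem hy, ← lintegral_kernelDensity hd hα hy.2]
    refine lintegral_congr fun x => ?_
    rw [Set.indicator_of_mem (by exact hy.1), if_pos (by exact hy.2)]
  · rw [Set.indicator_of_notMem hy]
    refine (lintegral_congr fun x => ?_).trans lintegral_zero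
    by_cases h1 : y ∈ s
    · rw [Set.indicator_of_mem (by exact h1), if_neg (by exact fun h => hy ⟨h1, h⟩)]
    · rw [Set.indicator_of_notMem (by exact h1)]

lemma tendsto_exp_neg_mul_rpow_zero {m γ : ℝ} (hm : 0 < m) (hγ : γ < 0) :
    Tendsto (fun s : ℝ => Real.exp (-(m * s ^ γ))) (𝓝[>] 0) (𝓝 0) :=
  Real.tendsto_exp_neg_atTop_nhds_zero.comp
    ((tendsto_rpow_neg_nhdsGT_zero hγ).const_mul_atTop hm)

lemma setLIntegral_Ioc_deriv_exp_neg_mul_rpow {m γ y : ℝ} (hm : 0 < m) (hγ : 0 < γ) (hy : 0 < y) :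
    ∫⁻ s in Set.Ioc 0 y, ENNReal.ofReal (Real.exp (-(m * s ^ (-γ))) * (m * (γ * s ^ (-γ - 1)))) =
      ENNReal.ofReal (Real.exp (-(m * y ^ (-γ)))) := by
  -- The real power takes the value 0 at s = 0, so the unmodified function would equal 1 there. The
  -- update installs the correct right limit 0, making F continuous on the closed interval.
  set F : ℝ → ℝ := Function.update (fun s => Real.exp (-(m * s ^ (-γ)))) 0 0 with hF
  have hFpos : ∀ s, 0 < s → F s = Real.exp (-(m * s ^ (-γ))) := fun s hs =>
    Function.update_of_ne hs.ne' _ _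
  have hder : ∀ s ∈ Set.Ioo 0 y,
      HasDerivAt F (Real.exp (-(m * s ^ (-γ))) * (m * (γ * s ^ (-γ - 1)))) s := by
    intro s hs
    have h := (((Real.hasDerivAt_rpow_const (p := -γ) (Or.inl hs.1.ne')).const_mul m).neg).exp
    have h' : HasDerivAt (fun s : ℝ => Real.exp (-(m * s ^ (-γ))))
        (Real.exp (-(m * s ^ (-γ))) * (m * (γ * s ^ (-γ - 1)))) s := by
      refine h.congr_deriv ?_
      simp only [Pi.neg_apply]
      ring
    refine h'.congr_of_eventuallyEq ?_
    filter_upwards [lt_mem_nhds hs.1] with u hu using hFpos u hu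
  have hcont : ContinuousOn F (Set.Icc 0 y) := by
    intro s hs
    rcases hs.1.eq_or_lt with rfl | h
    · rw [continuousWithinAt_update_same]
      refine (tendsto_exp_neg_mul_rpow_zero hm (neg_lt_zero.2 hγ)).mono_left ?_
      refine nhdsWithin_mono _ fun u hu => lt_of_le_of_ne hu.1.1 (Ne.symm hu.2)
    · refine ContinuousAt.continuousWithinAt ?_
      refine ContinuousAt.congr (f := fun s : ℝ => Real.exp (-(m * s ^ (-γ)))) ?_ ?_
      · exact ((((Real.continuousAt_rpow_const s (-γ) (Or.inl h.ne')).const_mul m)).neg).rexp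
      · filter_upwards [lt_mem_nhds h] with u hu using (hFpos u hu).symm
  have hnn : ∀ s ∈ Set.Ioo 0 y, 0 ≤ Real.exp (-(m * s ^ (-γ))) * (m * (γ * s ^ (-γ - 1))) := by
    intro s hs
    have := Real.rpow_nonneg hs.1.le (-γ - 1)
    positivity
  have hint := intervalIntegral.integrableOn_deriv_of_nonneg hcont hder hnn
  have hftc := intervalIntegral.integral_eq_sub_of_hasDerivAt_of_le hy.le hcont hder
    ((intervalIntegrable_iff_integrableOn_Ioc_of_le hy.le).2 hint)
  rw [← ofReal_integral_eq_lintegral_ofReal hint, ← intervalIntegral.integral_of_le hy.le, hftc,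
    hFpos y hy, hF, Function.update_self, sub_zero]
  filter_upwards [ae_restrict_mem measurableSet_Ioc] with s hs
  have := Real.rpow_nonneg hs.1.le (-γ - 1)
  simp only [Pi.zero_apply]
  positivity

lemma jointLimitLaw_snd_le (hd : 1 ≤ d) (hα : (d : ℝ) < α) {y : ℝ} (hy : 0 < y) :
    jointLimitLaw d α {v | v.2 ≤ y} =
      ENNReal.ofReal (Real.exp (-(mu d α * y ^ ((d : ℝ) - α)))) := by
  have h := jointLimitLaw_snd_preimage hd hα (measurableSet_Iic (a := y))
  rw [show Set.Iic y ∩ Set.Ioi 0 = Set.Ioc 0 y by ext; simp [and_comm]] at h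
  have h2 := setLIntegral_Ioc_deriv_exp_neg_mul_rpow (mu_pos hd hα) (sub_pos.2 hα) hy
  rw [neg_sub] at h2
  exact h.trans h2

lemma isProbabilityMeasure_jointLimitLaw (hd : 1 ≤ d) (hα : (d : ℝ) < α) :
    IsProbabilityMeasure (jointLimitLaw d α) := by
  constructor
  have hU : (Set.univ : Set ((Fin d → ℝ) × ℝ)) = ⋃ n : ℕ, {v | v.2 ≤ (n : ℝ)} := by
    ext v; simpa using exists_nat_ge v.2
  have hmono : Monotone fun n : ℕ => {v : (Fin d → ℝ) × ℝ | v.2 ≤ (n : ℝ)} := fun m n h v hv =>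
    le_trans (show v.2 ≤ (m : ℝ) from hv) (by exact_mod_cast h)
  have h1 := tendsto_measure_iUnion_atTop (μ := jointLimitLaw d α) hmono
  rw [← hU] at h1
  have h2 : Tendsto (fun n : ℕ => ENNReal.ofReal (Real.exp (-(mu d α * (n : ℝ) ^ ((d : ℝ) - α)))))
      atTop (𝓝 1) := by
    have h3 : Tendsto (fun n : ℕ => (n : ℝ) ^ ((d : ℝ) - α)) atTop (𝓝 0) := by
      have := (tendsto_rpow_neg_atTop (sub_pos.2 hα)).comp tendsto_natCast_atTop_atTop
      simpa [Function.comp_def] using this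
    have h4 := ((h3.const_mul (mu d α)).neg.rexp)
    have h5 := (ENNReal.continuous_ofReal.tendsto _).comp h4
    simpa [Function.comp_def] using h5
  refine tendsto_nhds_unique h1 (h2.congr' ?_)
  filter_upwards [eventually_gt_atTop 0] with n hn
  exact (jointLimitLaw_snd_le hd hα (by exact_mod_cast hn)).symm

/-- `p` is a Bochner integral and would default to 0 if divergent. Finiteness of the total mass
gives integrability in y for almost every x, which is all that a density requires. -/
lemma lintegral_jointDensity_eq_p (hd : 1 ≤ d) (hα : (d : ℝ) < α) :
    (fun x => ∫⁻ y, if 0 < y then ENNReal.ofReal (kernelDensity d α x y) else 0) =ᵐ[volume]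
      fun x => ENNReal.ofReal (p d α x) := by
  have hm := measurable_jointDensity d α
  have hfin : ∫⁻ x : Fin d → ℝ, ∫⁻ y : ℝ,
      (if 0 < y then ENNReal.ofReal (kernelDensity d α x y) else 0) ≠ ∞ := by
    have h1 := (isProbabilityMeasure_jointLimitLaw hd hα).measure_univ
    rw [jointLimitLaw, withDensity_apply _ MeasurableSet.univ, Measure.restrict_univ,
      Measure.volume_eq_prod, lintegral_prod _ hm.aemeasurable] at h1
    exact h1.trans_ne ENNReal.one_ne_top
  have hae := ae_lt_top (hm.lintegral_prod_right') hfin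
  have h0 : (0 : ℝ) < d := by exact_mod_cast hd
  have hq := q_pos hd hα
  filter_upwards [hae] with x hx
  have hind : ∀ y : ℝ, (if 0 < y then ENNReal.ofReal (kernelDensity d α x y) else 0) =
      (Set.Ioi (0 : ℝ)).indicator (fun y => ENNReal.ofReal (kernelDensity d α x y)) y := by
    intro y; simp [Set.indicator_apply]
  have hnn : 0 ≤ᵐ[volume.restrict (Set.Ioi (0 : ℝ))] fun y => kernelDensity d α x y := by
    filter_upwards [ae_restrict_mem measurableSet_Ioi] with y hy
    have hy : 0 < y := hy
    have := l1norm_nonneg x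
    have : 0 < α := h0.trans hα
    simp only [Pi.zero_apply, kernelDensity]
    positivity
  simp_rw [hind] at hx ⊢
  rw [lintegral_indicator measurableSet_Ioi] at hx ⊢
  have hmx : Measurable fun y => kernelDensity d α x y := by unfold kernelDensity; fun_prop
  rw [← ofReal_integral_eq_lintegral_ofReal ?_ hnn]
  · congr 1
    simp only [kernelDensity, p]
    rw [integral_const_mul]
  · refine ⟨hmx.aestronglyMeasurable, ?_⟩
    rw [hasFiniteIntegral_iff_ofReal hnn]
    exact hx

lemma map_fst_jointLimitLaw (hd : 1 ≤ d) (hα : (d : ℝ) < α) :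
    (jointLimitLaw d α).map Prod.fst = limitLaw d α := by
  have hm := measurable_jointDensity d α
  ext s hs
  rw [Measure.map_apply measurable_fst hs, jointLimitLaw, limitLaw, withDensity_apply _ hs,
    withDensity_apply _ (measurable_fst hs),
    ← setLIntegral_congr_fun_ae hs ((lintegral_jointDensity_eq_p hd hα).mono fun x hx _ => hx),
    ← lintegral_indicator (measurable_fst hs), ← lintegral_indicator hs, Measure.volume_eq_prod,
    lintegral_prod _ (hm.indicator (measurable_fst hs)).aemeasurable]
  refine lintegral_congr fun x => ?_
  by_cases hx : x ∈ s
  · rw [Set.indicator_of_mem hx]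
    exact lintegral_congr fun y => Set.indicator_of_mem (by exact hx) _
  · rw [Set.indicator_of_notMem hx]
    exact (lintegral_congr fun y => Set.indicator_of_notMem (by exact hx) _).trans lintegral_zero

lemma isProbabilityMeasure_limitLaw (hd : 1 ≤ d) (hα : (d : ℝ) < α) :
    IsProbabilityMeasure (limitLaw d α) := by
  have := isProbabilityMeasure_jointLimitLaw hd hα
  rw [← map_fst_jointLimitLaw hd hα]
  exact Measure.isProbabilityMeasure_map measurable_fst.aemeasurable

end Constants

/-! ### The cost in rescaled units -/

/-- The deterministic cost `(N / t) log (N / (2 d e t))` subtracted from the potential at a site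
with `ℓ¹`-norm `N`. -/
def cost (d : ℕ) (t N : ℝ) : ℝ := N / t * Real.log (N / (2 * d * Real.exp 1 * t))

/-- The coefficient of the linear term of the rescaled cost. -/
def costSlope (d : ℕ) (α t : ℝ) : ℝ :=
  (q d α * Real.log t - (q d α + 1) * Real.log (Real.log t) - Real.log (2 * d * Real.exp 1)) /
    Real.log t

lemma Psi_eq {d : ℕ} (ξ : (Fin d → ℤ) → ℝ) (t : ℝ) (z : Fin d → ℤ) :
    Psi ξ t z = ξ z - cost d t (l1norm (toReal z)) := rfl

/-- With ρ = (log t / t)^(q+1) N, substitute log N = log ρ + (q+1)(log t - log log t). One log t is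
absorbed by the t inside the logarithm, leaving slope q to leading order and a ρ log ρ term damped
by 1/log t. -/
lemma rescaled_cost {d : ℕ} (hd : 1 ≤ d) {α t N : ℝ} (ht : 1 < t) (hN : 0 ≤ N) :
    (Real.log t / t) ^ q d α * cost d t N =
      (Real.log t / t) ^ (q d α + 1) * N * Real.log ((Real.log t / t) ^ (q d α + 1) * N) /
        Real.log t + (Real.log t / t) ^ (q d α + 1) * N * costSlope d α t := by
  rcases hN.eq_or_lt with rfl | hN
  · simp [cost]
  have h0 : (0 : ℝ) < d := by exact_mod_cast hd
  have hl : 0 < Real.log t := Real.log_pos ht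
  have ht0 : 0 < t := by linarith
  have hs : 0 < Real.log t / t := by positivity
  have hsq := Real.rpow_pos_of_pos hs (q d α)
  have hE := Real.exp_pos 1
  rw [Real.log_mul (Real.rpow_pos_of_pos hs _).ne' hN.ne', Real.log_rpow hs,
    Real.log_div hl.ne' ht0.ne', Real.rpow_add hs, Real.rpow_one, cost, costSlope,
    Real.log_div hN.ne' (by positivity), Real.log_mul (x := 2 * d * Real.exp 1) (by positivity)
    ht0.ne']
  field_simp
  ring

lemma tendsto_costSlope (d : ℕ) (α : ℝ) : Tendsto (costSlope d α) atTop (𝓝 (q d α)) := by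
  have h1 : Tendsto (fun t : ℝ => Real.log (Real.log t) / Real.log t) atTop (𝓝 0) :=
    (Real.isLittleO_log_id_atTop.tendsto_div_nhds_zero).comp Real.tendsto_log_atTop
  have h2 : Tendsto (fun t : ℝ => Real.log (2 * d * Real.exp 1) / Real.log t) atTop (𝓝 0) :=
    Real.tendsto_log_atTop.const_div_atTop _
  have h3 := ((tendsto_const_nhds (x := q d α)).sub (h1.const_mul (q d α + 1))).sub h2
  rw [mul_zero, sub_zero, sub_zero] at h3
  refine h3.congr' ?_
  filter_upwards [Real.tendsto_log_atTop.eventually_gt_atTop 0] with t ht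
  rw [costSlope]; field_simp

lemma neg_one_le_mul_log {x : ℝ} (hx : 0 ≤ x) : -1 ≤ x * Real.log x := by
  rcases hx.eq_or_lt with rfl | hx
  · simp
  have := mul_le_mul_of_nonneg_left (Real.one_sub_inv_le_log_of_pos hx) hx.le
  rw [mul_sub, mul_inv_cancel₀ hx.ne'] at this
  linarith

/-- A uniform linear lower bound for the rescaled cost. -/
lemma eventually_le_rescaled_cost {d : ℕ} (hd : 1 ≤ d) {α : ℝ} (hα : (d : ℝ) < α) {y : ℝ}
    (hy : 0 < y) : ∀ᶠ t : ℝ in atTop, ∀ N : ℝ, 0 ≤ N →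
      y / 2 + q d α / 2 * ((Real.log t / t) ^ (q d α + 1) * N) ≤
        y + (Real.log t / t) ^ q d α * cost d t N := by
  have hq := q_pos hd hα
  -- Since ρ log ρ ≥ -1, the damped term costs at most y/2 once log t ≥ 2/y; the slope eventually
  -- exceeds q/2.
  filter_upwards [(tendsto_costSlope d α).eventually (lt_mem_nhds (half_lt_self hq)),
    eventually_gt_atTop 1, Real.tendsto_log_atTop.eventually_ge_atTop (2 / y)] with t h1 ht h2 N hN
  have hl : 0 < Real.log t := Real.log_pos ht
  have hs : 0 < Real.log t / t := div_pos hl (by linarith)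
  rw [rescaled_cost hd ht hN]
  set ρ := (Real.log t / t) ^ (q d α + 1) * N
  have hρ : 0 ≤ ρ := mul_nonneg (Real.rpow_nonneg hs.le _) hN
  have h3 : -(y / 2) ≤ ρ * Real.log ρ / Real.log t := by
    rw [le_div_iff₀ hl]
    refine le_trans ?_ (neg_one_le_mul_log hρ)
    rw [div_le_iff₀ hy] at h2
    linarith
  have h4 := mul_le_mul_of_nonneg_left h1.le hρ
  linarith

lemma tendsto_log_div_self : Tendsto (fun t : ℝ => Real.log t / t) atTop (𝓝[>] 0) := by
  refine tendsto_nhdsWithin_iff.2 ⟨Real.isLittleO_log_id_atTop.tendsto_div_nhds_zero, ?_⟩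
  filter_upwards [eventually_gt_atTop 1] with t ht
  exact div_pos (Real.log_pos ht) (by linarith)

lemma tendsto_log_div_self_rpow {γ : ℝ} (hγ : 0 < γ) :
    Tendsto (fun t : ℝ => (Real.log t / t) ^ γ) atTop (𝓝[>] 0) := by
  have h : Tendsto (fun s : ℝ => s ^ γ) (𝓝[>] 0) (𝓝[>] 0) := by
    refine tendsto_nhdsWithin_iff.2 ⟨?_, ?_⟩
    · have := (Real.continuousAt_rpow_const 0 γ (Or.inr hγ.le)).tendsto
      rw [Real.zero_rpow hγ.ne'] at this
      exact this.mono_left nhdsWithin_le_nhds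
    · filter_upwards [self_mem_nhdsWithin] with s hs using Real.rpow_pos_of_pos hs _
  exact h.comp tendsto_log_div_self

/-! ### Lattice sums as integrals -/

/-- The coordinatewise floor `ℝ^d → ℤ^d`. -/
def latticeFloor {d : ℕ} (x : Fin d → ℝ) : Fin d → ℤ := fun i => ⌊x i⌋

@[fun_prop]
lemma measurable_latticeFloor {d : ℕ} : Measurable (latticeFloor : (Fin d → ℝ) → (Fin d → ℤ)) :=
  measurable_pi_lambda _ fun i => (measurable_pi_apply i).floor

lemma map_latticeFloor_volume (d : ℕ) :
    (volume : Measure (Fin d → ℝ)).map latticeFloor = Measure.count := by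
  refine Measure.ext_of_singleton fun z => ?_
  rw [Measure.count_singleton, Measure.map_apply measurable_latticeFloor (measurableSet_singleton z)]
  have : latticeFloor ⁻¹' {z} = Set.univ.pi fun i => Set.Ico (z i : ℝ) (z i + 1) := by
    ext x
    simp [latticeFloor, funext_iff, Int.floor_eq_iff]
  rw [this, volume_pi_pi]
  simp

lemma lintegral_latticeFloor {d : ℕ} (f : (Fin d → ℤ) → ℝ≥0∞) :
    ∫⁻ x, f (latticeFloor x) = ∑' z, f z := by
  rw [← lintegral_count, ← map_latticeFloor_volume,
    lintegral_map (measurable_of_countable f) measurable_latticeFloor]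

lemma tsum_eq_lintegral_latticeFloor_smul {d : ℕ} (f : (Fin d → ℤ) → ℝ≥0∞) {r : ℝ} (hr : 0 < r) :
    ∑' z, f z = ENNReal.ofReal (r ^ d) * ∫⁻ x : Fin d → ℝ, f (latticeFloor (r • x)) := by
  have hm : Measurable fun x : Fin d → ℝ => f (latticeFloor x) :=
    (measurable_of_countable f).comp measurable_latticeFloor
  rw [← lintegral_map (f := fun x => f (latticeFloor x)) hm (measurable_const_smul r),
    Measure.map_addHaar_smul _ hr.ne', lintegral_smul_measure, lintegral_latticeFloor,
    Module.finrank_fin_fun, smul_eq_mul, ← mul_assoc, ← ENNReal.ofReal_mul (by positivity),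
    abs_of_pos (by positivity), mul_inv_cancel₀ (by positivity), ENNReal.ofReal_one, one_mul]

lemma l1norm_sub_le_toReal_latticeFloor {d : ℕ} (x : Fin d → ℝ) :
    l1norm x - d ≤ l1norm (toReal (latticeFloor x)) := by
  have : ∑ i : Fin d, (|x i| - 1) ≤ l1norm (toReal (latticeFloor x)) := by
    refine Finset.sum_le_sum fun i _ => ?_
    have h1 := Int.floor_le (x i)
    have h2 := Int.lt_floor_add_one (x i)
    have h3 := abs_sub_abs_le_abs_sub (x i) (⌊x i⌋ : ℝ)
    have h4 : |x i - (⌊x i⌋ : ℝ)| ≤ 1 := abs_le.2 ⟨by linarith, by linarith⟩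
    simp only [toReal, latticeFloor]
    linarith
  simpa [Finset.sum_sub_distrib, l1norm] using this

/-- The lattice `ε ℤ^d` discretisation of a point of `ℝ^d`. -/
def discretise {d : ℕ} (ε : ℝ) (x : Fin d → ℝ) : Fin d → ℝ :=
  ε • toReal (latticeFloor (ε⁻¹ • x))

lemma tendsto_discretise {d : ℕ} (x : Fin d → ℝ) :
    Tendsto (fun ε => discretise ε x) (𝓝[>] 0) (𝓝 x) := by
  refine tendsto_pi_nhds.2 fun i => ?_
  have h1 : Tendsto (fun ε : ℝ => x i - ε) (𝓝[>] 0) (𝓝 (x i)) := by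
    have : Tendsto (fun ε : ℝ => x i - ε) (𝓝 0) (𝓝 (x i - 0)) :=
      tendsto_const_nhds.sub tendsto_id
    rw [sub_zero] at this
    exact this.mono_left nhdsWithin_le_nhds
  refine tendsto_of_tendsto_of_tendsto_of_le_of_le' h1 tendsto_const_nhds ?_ ?_
  all_goals
    filter_upwards [self_mem_nhdsWithin] with ε hε
    have hε : 0 < ε := hε
    have h2 := Int.floor_le (ε⁻¹ * x i)
    have h3 := Int.lt_floor_add_one (ε⁻¹ * x i)
    have h4 : ε * (ε⁻¹ * x i) = x i := by field_simp
    simp only [discretise, toReal, latticeFloor, Pi.smul_apply, smul_eq_mul]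
    nlinarith

lemma l1norm_sub_le_discretise {d : ℕ} {ε : ℝ} (hε : 0 < ε) (x : Fin d → ℝ) :
    l1norm x - ε * d ≤ l1norm (discretise ε x) := by
  have h := mul_le_mul_of_nonneg_left (l1norm_sub_le_toReal_latticeFloor (ε⁻¹ • x)) hε.le
  rw [l1norm_smul, abs_of_pos (inv_pos.2 hε), mul_sub, ← mul_assoc, mul_inv_cancel₀ hε.ne',
    one_mul] at h
  rwa [discretise, l1norm_smul, abs_of_pos hε]

/-! ### Convergence of the rescaled tail sums -/

section Asymptotics

variable {d : ℕ} {α : ℝ}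

/-- The spatial mesh `(log t / t)^(q + 1)`. -/
def mesh (d : ℕ) (α t : ℝ) : ℝ := (Real.log t / t) ^ (q d α + 1)

/-- The rescaled cost at the lattice point next to `x`. -/
def latticeCost (d : ℕ) (α t : ℝ) (x : Fin d → ℝ) : ℝ :=
  (Real.log t / t) ^ q d α *
    cost d t (l1norm (toReal (latticeFloor ((mesh d α t)⁻¹ • x))))

lemma tendsto_mesh (hd : 1 ≤ d) (hα : (d : ℝ) < α) : Tendsto (mesh d α) atTop (𝓝[>] 0) :=
  tendsto_log_div_self_rpow (by linarith [q_pos hd hα])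

lemma mesh_pos {t : ℝ} (ht : 1 < t) : 0 < mesh d α t :=
  Real.rpow_pos_of_pos (div_pos (Real.log_pos ht) (by linarith)) _

lemma mesh_mul_l1norm {t : ℝ} (ht : 1 < t) (x : Fin d → ℝ) :
    mesh d α t * l1norm (toReal (latticeFloor ((mesh d α t)⁻¹ • x))) =
      l1norm (discretise (mesh d α t) x) := by
  rw [discretise, l1norm_smul, abs_of_pos (mesh_pos ht)]

lemma tendsto_latticeCost (hd : 1 ≤ d) (hα : (d : ℝ) < α) (x : Fin d → ℝ) :
    Tendsto (fun t => latticeCost d α t x) atTop (𝓝 (q d α * l1norm x)) := by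
  have h1 : Tendsto (fun t => l1norm (discretise (mesh d α t) x)) atTop (𝓝 (l1norm x)) :=
    (continuous_l1norm.tendsto x).comp ((tendsto_discretise x).comp (tendsto_mesh hd hα))
  have h2 := ((Real.continuous_mul_log.tendsto _).comp h1).div_atTop Real.tendsto_log_atTop
  have h3 := h2.add (h1.mul (tendsto_costSlope d α))
  rw [zero_add, mul_comm] at h3
  refine h3.congr' ?_
  filter_upwards [eventually_gt_atTop 1] with t ht
  rw [latticeCost, rescaled_cost hd ht (l1norm_nonneg _), ← mesh, mesh_mul_l1norm ht]
  rfl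

/-- This supplies the dominating function, uniformly in x. Discretisation shortens |x| by at most
mesh·d, so a mesh below y/(2qd) loses at most another y/4. -/
lemma eventually_le_latticeCost (hd : 1 ≤ d) (hα : (d : ℝ) < α) {y : ℝ} (hy : 0 < y) :
    ∀ᶠ t : ℝ in atTop, ∀ x : Fin d → ℝ,
      y / 4 + q d α / 2 * l1norm x ≤ y + latticeCost d α t x := by
  have hq := q_pos hd hα
  have h0 : (0 : ℝ) < d := by exact_mod_cast hd
  have hpos : 0 < y / (2 * q d α * d) := by positivity
  filter_upwards [eventually_le_rescaled_cost hd hα hy, eventually_gt_atTop 1,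
    (tendsto_nhdsWithin_iff.1 (tendsto_mesh hd hα)).1.eventually (gt_mem_nhds hpos)]
    with t h1 ht h2 x
  have h3 := h1 _ (l1norm_nonneg (toReal (latticeFloor ((mesh d α t)⁻¹ • x))))
  rw [← mesh, mesh_mul_l1norm ht] at h3
  have h4 := l1norm_sub_le_discretise (mesh_pos (d := d) (α := α) ht) x
  rw [lt_div_iff₀ (by positivity)] at h2
  have h5 := mul_le_mul_of_nonneg_left h4 (half_pos hq).le
  rw [latticeCost]
  linarith

/-- This identity fixes the scaling: tail probability per site times number of sites per unit volume
is exactly 1, as `rpow_mul_mesh_inv_pow` records. -/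
lemma q_mul_eq (hα : (d : ℝ) < α) : q d α * α = (q d α + 1) * d := by
  have : α - d ≠ 0 := by linarith
  rw [q]; field_simp; ring

lemma rpow_mul_mesh_inv_pow (hα : (d : ℝ) < α) {t : ℝ} (ht : 1 < t) :
    (Real.log t / t) ^ (q d α * α) * (mesh d α t)⁻¹ ^ d = 1 := by
  have hs : 0 < Real.log t / t := div_pos (Real.log_pos ht) (by linarith)
  rw [q_mul_eq hα, mesh, ← Real.rpow_neg hs.le, ← Real.rpow_natCast, ← Real.rpow_mul hs.le,
    ← Real.rpow_add hs, neg_mul, add_neg_cancel, Real.rpow_zero]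

lemma measurable_latticeCost (t : ℝ) : Measurable (latticeCost d α t) := by
  have h : Measurable fun z : Fin d → ℤ =>
      (Real.log t / t) ^ q d α * cost d t (l1norm (toReal z)) := measurable_of_countable _
  exact h.comp (measurable_latticeFloor.comp (measurable_const_smul _))

/-- The rescaled sum of the tail probabilities at level `y` converges. -/
lemma tendsto_tsum_rpow_neg (hd : 1 ≤ d) (hα : (d : ℝ) < α) {y : ℝ} (hy : 0 < y) :
    Tendsto (fun t : ℝ => ∑' z : Fin d → ℤ, ENNReal.ofReal ((Real.log t / t) ^ (q d α * α) *
        (y + (Real.log t / t) ^ q d α * cost d t (l1norm (toReal z))) ^ (-α)))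
      atTop (𝓝 (ENNReal.ofReal (mu d α * y ^ ((d : ℝ) - α)))) := by
  have h0 : (0 : ℝ) < d := by exact_mod_cast hd
  have hα0 : 0 < α := h0.trans hα
  have hq := q_pos hd hα
  rw [← lintegral_rpow_neg_eq_mu hd hα hy]
  have key : Tendsto (fun t : ℝ => ∫⁻ x : Fin d → ℝ,
      ENNReal.ofReal ((y + latticeCost d α t x) ^ (-α))) atTop
      (𝓝 (∫⁻ x : Fin d → ℝ, ENNReal.ofReal ((y + q d α * l1norm x) ^ (-α)))) := by
    -- The dominating function is integrable precisely because α > d.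
    refine tendsto_lintegral_filter_of_dominated_convergence
      (fun x => ENNReal.ofReal ((y / 4 + q d α / 2 * l1norm x) ^ (-α))) ?_ ?_ ?_ ?_
    · refine Eventually.of_forall fun t => ?_
      have := measurable_latticeCost (d := d) (α := α) t
      fun_prop
    · filter_upwards [eventually_le_latticeCost hd hα hy] with t ht
      refine ae_of_all _ fun x => ENNReal.ofReal_le_ofReal ?_
      have := l1norm_nonneg x
      exact Real.rpow_le_rpow_of_nonpos (by positivity) (ht x) (by linarith)
    · rw [lintegral_add_mul_l1norm_rpow d hα (by positivity) (by positivity)]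
      exact ENNReal.ofReal_ne_top
    · refine ae_of_all _ fun x => (ENNReal.continuous_ofReal.tendsto _).comp ?_
      refine ((tendsto_latticeCost hd hα x).const_add y).rpow_const (Or.inl ?_)
      have := l1norm_nonneg x
      positivity
  refine key.congr' ?_
  filter_upwards [eventually_gt_atTop 1] with t ht
  have hs : 0 < Real.log t / t := div_pos (Real.log_pos ht) (by linarith)
  rw [tsum_eq_lintegral_latticeFloor_smul _ (inv_pos.2 (mesh_pos (d := d) (α := α) ht))]
  simp_rw [ENNReal.ofReal_mul (Real.rpow_nonneg hs.le (q d α * α))]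
  rw [lintegral_const_mul' _ _ ENNReal.ofReal_ne_top, ← mul_assoc,
    ← ENNReal.ofReal_mul (pow_nonneg (inv_pos.2 (mesh_pos ht)).le _),
    mul_comm ((mesh d α t)⁻¹ ^ d), rpow_mul_mesh_inv_pow hα ht, ENNReal.ofReal_one, one_mul]
  rfl

end Asymptotics

/-! ### The Pareto law -/

lemma paretoMeasure_one_Ioi {α x : ℝ} (hα : 0 < α) (hx : 1 ≤ x) :
    paretoMeasure 1 α (Set.Ioi x) = ENNReal.ofReal (x ^ (-α)) := by
  have hx0 : 0 < x := by linarith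
  have h1 : ∀ s ∈ Set.Ioi x, paretoPDF 1 α s = ENNReal.ofReal (α * s ^ (-α - 1)) := by
    intro s hs
    rw [paretoPDF_of_le (hx.trans (le_of_lt hs)), Real.one_rpow, mul_one, neg_add']
  have hint : IntegrableOn (fun s : ℝ => α * s ^ (-α - 1)) (Set.Ioi x) :=
    (integrableOn_Ioi_rpow_of_lt (by linarith) hx0).const_mul α
  rw [paretoMeasure, withDensity_apply _ measurableSet_Ioi,
    setLIntegral_congr_fun measurableSet_Ioi h1, ← ofReal_integral_eq_lintegral_ofReal hint]
  · rw [integral_const_mul, integral_Ioi_rpow_of_lt (by linarith) hx0, sub_add_cancel]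
    congr 1; field_simp
  · filter_upwards [ae_restrict_mem measurableSet_Ioi] with s hs
    exact mul_nonneg hα.le (Real.rpow_nonneg (hx0.trans hs).le _)

/-- The hypothesis at x = 1 says that no mass lies in (-∞, 1], so the distribution function is known
below 1 as well. -/
lemma eq_paretoMeasure_one {α : ℝ} (hα : 0 < α) {ν : Measure ℝ} [IsProbabilityMeasure ν]
    (h : ∀ x, 1 ≤ x → ν (Set.Iic x) = ENNReal.ofReal (1 - x ^ (-α))) :
    ν = paretoMeasure 1 α := by
  have := isProbabilityMeasure_paretoMeasure one_pos hα
  have h2 : ∀ x, 1 ≤ x → paretoMeasure 1 α (Set.Iic x) = ENNReal.ofReal (1 - x ^ (-α)) := by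
    intro x hx
    rw [← Set.compl_Ioi, prob_compl_eq_one_sub measurableSet_Ioi, paretoMeasure_one_Ioi hα hx,
      ENNReal.ofReal_sub _ (Real.rpow_nonneg (by linarith) _), ENNReal.ofReal_one]
  refine Measure.ext_of_Iic _ _ fun x => ?_
  rcases le_total 1 x with hx | hx
  · rw [h x hx, h2 x hx]
  · have h0 : ∀ κ : Measure ℝ, κ (Set.Iic 1) = ENNReal.ofReal (1 - 1 ^ (-α)) →
        κ (Set.Iic x) = 0 := by
      intro κ hκ
      refine measure_mono_null (Set.Iic_subset_Iic.2 hx) ?_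
      rw [hκ, Real.one_rpow, sub_self, ENNReal.ofReal_zero]
    rw [h0 _ (h 1 le_rfl), h0 _ (h2 1 le_rfl)]

lemma paretoMeasure_singleton (t α x : ℝ) : paretoMeasure t α {x} = 0 :=
  withDensity_absolutelyContinuous _ _ Real.volume_singleton

/-! ### Independent fields indexed by a countable set -/

/-- From 1/(1-c) = 1 + c/(1-c) ≤ 1 + c/(1-δ) ≤ exp(c/(1-δ)). It turns products of 1 - c into
exponentials of sums, with an error factor that disappears as δ → 0. -/
lemma exp_neg_div_le_one_sub {c δ : ℝ} (hc : 0 ≤ c) (hcδ : c ≤ δ) (hδ : δ < 1) :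
    Real.exp (-(c / (1 - δ))) ≤ 1 - c := by
  have h1 : 0 < 1 - δ := by linarith
  have h2 : 0 < 1 - c := by linarith
  have h3 : c / (1 - c) ≤ c / (1 - δ) := by gcongr
  rw [Real.exp_neg, inv_le_comm₀ (Real.exp_pos _) h2]
  calc (1 - c)⁻¹ = c / (1 - c) + 1 := by field_simp; ring
    _ ≤ c / (1 - δ) + 1 := by linarith
    _ ≤ _ := Real.add_one_le_exp _

lemma ae_sub_ne_sub {ι Ω : Type*} [MeasurableSpace Ω] {P : Measure Ω}
    [IsProbabilityMeasure P] {ξ : ι → Ω → ℝ} {α : ℝ} (hmeas : ∀ z, Measurable (ξ z)) (hindep : iIndepFun ξ P)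
    (hlaw : ∀ z, P.map (ξ z) = paretoMeasure 1 α) (c : ι → ℝ) {z z' : ι} (hz : z ≠ z') :
    ∀ᵐ ω ∂P, ξ z ω - c z ≠ ξ z' ω - c z' := by
  have hpair := (hindep.indepFun hz).map_prod_eq_prod_map_map (hmeas z).aemeasurable
    (hmeas z').aemeasurable
  have hT : MeasurableSet {v : ℝ × ℝ | v.1 - c z = v.2 - c z'} :=
    measurableSet_eq_fun (by fun_prop) (by fun_prop)
  have h0 : (P.map fun ω => (ξ z ω, ξ z' ω)) {v : ℝ × ℝ | v.1 - c z = v.2 - c z'} = 0 := by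
    have := Measure.isProbabilityMeasure_map (μ := P) (hmeas z').aemeasurable
    rw [hpair, Measure.prod_apply hT]
    refine (lintegral_congr fun s => ?_).trans lintegral_zero
    rw [hlaw z']
    refine measure_mono_null (t := {s - c z + c z'}) ?_ (paretoMeasure_singleton _ _ _)
    intro u hu
    have hu : s - c z = u - c z' := hu
    exact Set.mem_singleton_iff.2 (by linarith)
  rw [Measure.map_apply ((hmeas z).prodMk (hmeas z')) hT] at h0
  rw [ae_iff]
  refine (congrArg P ?_).trans h0
  ext ω; simp

lemma measurable_measure_forall_le {ι Ω : Type*} [MeasurableSpace Ω] {P : Measure Ω}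
    {ξ : ι → Ω → ℝ} (c : ι → ℝ) :
    Measurable fun u : ℝ => P {ω | ∀ z, ξ z ω ≤ u + c z} := by
  refine Monotone.measurable fun u v huv => measure_mono fun ω hω z => ?_
  linarith [hω z]

section Field

variable {ι Ω : Type*} [Countable ι] [MeasurableSpace Ω] {P : Measure Ω} [IsProbabilityMeasure P]
  {ξ : ι → Ω → ℝ}

/-- A lower bound for the probability that an independent Pareto field stays below `b`. -/
lemma exp_neg_le_measure_forall_le {α : ℝ} (hα : 0 < α) (hmeas : ∀ z, Measurable (ξ z))
    (hindep : iIndepFun ξ P) (hlaw : ∀ z, P.map (ξ z) = paretoMeasure 1 α) {b : ι → ℝ} {δ : ℝ}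
    (hδ : δ < 1) (hb : ∀ z, 1 ≤ b z) (hbδ : ∀ z, b z ^ (-α) ≤ δ)
    (hsum : ∑' z, ENNReal.ofReal (b z ^ (-α)) ≠ ∞) :
    ENNReal.ofReal (Real.exp (-((∑' z, ENNReal.ofReal (b z ^ (-α))).toReal / (1 - δ)))) ≤
      P {ω | ∀ z, ξ z ω ≤ b z} := by
  have := isProbabilityMeasure_paretoMeasure one_pos hα
  have hnn : ∀ z, 0 ≤ b z ^ (-α) := fun z => Real.rpow_nonneg (by linarith [hb z]) _
  have hone : ∀ z, P (ξ z ⁻¹' Set.Iic (b z)) = ENNReal.ofReal (1 - b z ^ (-α)) := by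
    intro z
    rw [← Measure.map_apply (hmeas z) measurableSet_Iic, hlaw z, ← Set.compl_Ioi,
      prob_compl_eq_one_sub measurableSet_Ioi, paretoMeasure_one_Ioi hα (hb z),
      ENNReal.ofReal_sub _ (hnn z), ENNReal.ofReal_one]
  have hset : {ω | ∀ z, ξ z ω ≤ b z} = ⋂ S : Finset ι, ⋂ z ∈ S, ξ z ⁻¹' Set.Iic (b z) := by
    ext ω
    simp only [Set.mem_ofPred_eq, Set.mem_iInter, Set.mem_preimage, Set.mem_Iic]
    exact ⟨fun h _ z _ => h z, fun h z => h {z} z (Finset.mem_singleton_self z)⟩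
  -- Independence only gives products over finite sets; continuity from above along finite subsets
  -- reaches the whole field.
  rw [hset, Directed.measure_iInter]
  · refine le_iInf fun S => ?_
    rw [hindep.measure_inter_preimage_eq_mul S fun z _ => measurableSet_Iic]
    simp_rw [hone]
    rw [← ENNReal.ofReal_prod_of_nonneg fun z _ => by linarith [hbδ z]]
    refine ENNReal.ofReal_le_ofReal ?_
    have h1 : ∑ z ∈ S, b z ^ (-α) ≤ (∑' z, ENNReal.ofReal (b z ^ (-α))).toReal := by
      have h2 := ENNReal.toReal_mono hsum
        (ENNReal.sum_le_tsum (f := fun z => ENNReal.ofReal (b z ^ (-α))) S)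
      rwa [← ENNReal.ofReal_sum_of_nonneg fun z _ => hnn z,
        ENNReal.toReal_ofReal (Finset.sum_nonneg fun z _ => hnn z)] at h2
    have h3 : 0 < 1 - δ := by linarith
    calc Real.exp (-((∑' z, ENNReal.ofReal (b z ^ (-α))).toReal / (1 - δ)))
        ≤ Real.exp (-((∑ z ∈ S, b z ^ (-α)) / (1 - δ))) := by gcongr
      _ = ∏ z ∈ S, Real.exp (-(b z ^ (-α) / (1 - δ))) := by
        rw [← Real.exp_sum, Finset.sum_neg_distrib, Finset.sum_div]
      _ ≤ ∏ z ∈ S, (1 - b z ^ (-α)) :=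
        Finset.prod_le_prod (fun _ _ => (Real.exp_pos _).le)
          fun z _ => exp_neg_div_le_one_sub (hnn z) (hbδ z) hδ
  · exact fun S => (Finset.measurableSet_biInter S
      fun z _ => hmeas z measurableSet_Iic).nullMeasurableSet
  · classical
    refine directed_of_isDirected_le fun S T hST => ?_
    exact Set.biInter_subset_biInter_left hST
  · exact ⟨∅, measure_ne_top _ _⟩

/-- Lower bound for the probability that the field `ξ - c` is maximal at `z` with value in `B`. -/
lemma lintegral_le_measure_isMax (hmeas : ∀ z, Measurable (ξ z)) (hindep : iIndepFun ξ P)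
    (c : ι → ℝ) (z : ι) {B : Set ℝ} (hB : MeasurableSet B) :
    ∫⁻ s, B.indicator 1 (s - c z) * P {ω | ∀ z', ξ z' ω ≤ s - c z + c z'} ∂(P.map (ξ z)) ≤
      P {ω | ξ z ω - c z ∈ B ∧ ∀ z', ξ z' ω - c z' ≤ ξ z ω - c z} := by
  -- The field away from z is independent of ξ(z), so the joint law is a product and Fubini
  -- conditions on the value s of ξ(z).
  set W : Ω → ({z' // z' ≠ z} → ℝ) := fun ω z' => ξ z' ω with hWdef
  have hW : Measurable W := measurable_pi_lambda _ fun z' => hmeas z'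
  have hind : IndepFun (ξ z) W P := by
    refine IndepFun.indepFun_process (hmeas z) (fun z' => hmeas z') fun I => ?_
    classical
    have h := hindep.indepFun_finset {z} (I.map (Function.Embedding.subtype _))
      (by simp) hmeas
    have hφ : Measurable fun f : ({z} : Finset ι) → ℝ => f ⟨z, Finset.mem_singleton_self z⟩ :=
      measurable_pi_apply _
    have hψ : Measurable fun (f : (I.map (Function.Embedding.subtype _)) → ℝ) (i : I) =>
        f ⟨i.1.1, Finset.mem_map_of_mem _ i.2⟩ :=
      measurable_pi_lambda _ fun i => measurable_pi_apply _
    exact h.comp hφ hψ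
  have hpair := hind.map_prod_eq_prod_map_map (hmeas z).aemeasurable hW.aemeasurable
  set T : Set (ℝ × ({z' // z' ≠ z} → ℝ)) :=
    {v | v.1 - c z ∈ B ∧ ∀ z', v.2 z' - c z' ≤ v.1 - c z} with hT
  have hTm : MeasurableSet T := by
    refine MeasurableSet.inter (s₁ := {v : ℝ × ({z' // z' ≠ z} → ℝ) | v.1 - c z ∈ B})
      ((measurable_fst.sub_const (c z)) hB) ?_
    have : {v : ℝ × ({z' // z' ≠ z} → ℝ) | ∀ z', v.2 z' - c z' ≤ v.1 - c z} =
        ⋂ z' : {z' // z' ≠ z}, {v | v.2 z' - c z' ≤ v.1 - c z} := by ext; simp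
    change MeasurableSet {v : ℝ × ({z' // z' ≠ z} → ℝ) | ∀ z', v.2 z' - c z' ≤ v.1 - c z}
    rw [this]
    exact MeasurableSet.iInter fun z' => measurableSet_le (by fun_prop) (by fun_prop)
  have hev : P {ω | ξ z ω - c z ∈ B ∧ ∀ z', ξ z' ω - c z' ≤ ξ z ω - c z} =
      (P.map fun ω => (ξ z ω, W ω)) T := by
    rw [Measure.map_apply ((hmeas z).prodMk hW) hTm]
    congr 1
    ext ω
    simp only [hT, hWdef, Set.mem_ofPred_eq, Set.mem_preimage]
    refine and_congr_right fun _ => ⟨fun h z' => h z', fun h z' => ?_⟩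
    by_cases hz : z' = z
    · rw [hz]
    · exact h ⟨z', hz⟩
  have := Measure.isProbabilityMeasure_map (μ := P) hW.aemeasurable
  rw [hev, hpair, Measure.prod_apply hTm]
  refine lintegral_mono fun s => ?_
  by_cases hs : s - c z ∈ B
  · rw [Set.indicator_of_mem hs, Pi.one_apply, one_mul, Measure.map_apply hW
      (measurable_prodMk_left hTm)]
    -- The integrand also imposes the constraint at z itself. This only shrinks the event, and lets
    -- the same distribution function of the maximum serve for every z.
    refine measure_mono fun ω hω => ⟨hs, fun z' => ?_⟩
    have := hω z'.1
    simp only [hWdef]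
    linarith
  · rw [Set.indicator_of_notMem hs, zero_mul]
    exact zero_le

/-- The bound `lintegral_le_measure_isMax` for Pareto fields, as a Lebesgue integral over the
rescaled value of the maximum. -/
lemma lintegral_paretoPDF_le_measure_isMax {α : ℝ} (hmeas : ∀ z, Measurable (ξ z))
    (hindep : iIndepFun ξ P) (hlaw : ∀ z, P.map (ξ z) = paretoMeasure 1 α) (c : ι → ℝ) (z : ι)
    {B : Set ℝ} (hB : MeasurableSet B) {a : ℝ} (ha : 0 < a) :
    ENNReal.ofReal a * ∫⁻ y, B.indicator 1 (a * y) * P {ω | ∀ z', ξ z' ω ≤ a * y + c z'} *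
        paretoPDF 1 α (a * y + c z) ≤
      P {ω | ξ z ω - c z ∈ B ∧ ∀ z', ξ z' ω - c z' ≤ ξ z ω - c z} := by
  refine le_trans (le_of_eq ?_) (lintegral_le_measure_isMax hmeas hindep c z hB)
  have hH := measurable_measure_forall_le (P := P) (ξ := ξ) c
  have hpdf : Measurable (paretoPDF 1 α) := (measurable_paretoPDFReal 1 α).ennreal_ofReal
  have hI : Measurable (B.indicator (1 : ℝ → ℝ≥0∞)) := measurable_one.indicator hB
  set F : ℝ → ℝ≥0∞ := fun u =>
    B.indicator 1 u * P {ω | ∀ z', ξ z' ω ≤ u + c z'} * paretoPDF 1 α (u + c z) with hF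
  have hFm : Measurable F := (hI.mul hH).mul (hpdf.comp (measurable_add_const _))
  have h1 : ENNReal.ofReal a * ∫⁻ y, F (a * y) = ∫⁻ u, F u := by
    have h2 := Measure.map_addHaar_smul (volume : Measure ℝ) ha.ne'
    rw [Module.finrank_self, pow_one] at h2
    have h3 : ∫⁻ y, F (a * y) = ∫⁻ u, F u ∂(volume.map (a • · : ℝ → ℝ)) :=
      (lintegral_map hFm (measurable_const_smul a)).symm
    rw [h3, h2, lintegral_smul_measure, smul_eq_mul, ← mul_assoc, ← ENNReal.ofReal_mul ha.le,
      abs_of_pos (inv_pos.2 ha), mul_inv_cancel₀ ha.ne', ENNReal.ofReal_one, one_mul]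
  refine h1.trans ?_
  have hg : Measurable fun s =>
      B.indicator (1 : ℝ → ℝ≥0∞) (s - c z) * P {ω | ∀ z', ξ z' ω ≤ s - c z + c z'} :=
    (hI.comp (measurable_sub_const _)).mul (hH.comp (measurable_sub_const (c z)))
  rw [hlaw z, paretoMeasure, lintegral_withDensity_eq_lintegral_mul _ hpdf hg,
    ← lintegral_add_right_eq_self (fun s => (paretoPDF 1 α * _) s) (c z)]
  refine lintegral_congr fun u => ?_
  simp only [hF, Pi.mul_apply, add_sub_cancel_right]
  rw [mul_comm]

end Field

/-! ### Existence, uniqueness and measurability of the maximiser -/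

section Maximiser

variable {d : ℕ} {α : ℝ}

/-- Apply ρ log ρ ≥ -1 to ρ = N/(2det·exp t): the cost is superlinear, hence above a line of slope 1
with a t-dependent intercept. -/
lemma le_cost (hd : 1 ≤ d) {t N : ℝ} (ht : 0 < t) (hN : 0 ≤ N) :
    N - 2 * d * Real.exp 1 * Real.exp t ≤ cost d t N := by
  have h0 : (0 : ℝ) < d := by exact_mod_cast hd
  rcases hN.eq_or_lt with rfl | hN
  · simp only [cost, zero_div, zero_mul, zero_sub]
    exact neg_nonpos.2 (by positivity)
  have hE := Real.exp_pos 1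
  have hT := Real.exp_pos t
  have hK : 0 < 2 * d * Real.exp 1 := by positivity
  have h1 := neg_one_le_mul_log (x := N / (2 * d * Real.exp 1 * t) / Real.exp t) (by positivity)
  rw [Real.log_div (x := N / (2 * d * Real.exp 1 * t)) (by positivity) hT.ne', Real.log_exp] at h1
  have h2 := mul_le_mul_of_nonneg_left h1 (mul_pos hK hT).le
  have h3 : 2 * d * Real.exp 1 * Real.exp t * (N / (2 * d * Real.exp 1 * t) / Real.exp t *
      (Real.log (N / (2 * d * Real.exp 1 * t)) - t)) = cost d t N - N := by
    rw [cost]; field_simp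
  linarith

lemma tsum_one_add_l1norm_rpow_ne_top (hα : (d : ℝ) < α) :
    ∑' z : Fin d → ℤ, ENNReal.ofReal ((1 + l1norm (toReal z)) ^ (-α)) ≠ ∞ := by
  have h0 : (0 : ℝ) ≤ d := Nat.cast_nonneg d
  have hc : (0 : ℝ) < 1 / (1 + d) := by positivity
  rw [← lintegral_latticeFloor]
  refine ne_top_of_le_ne_top ?_ (lintegral_mono
    (g := fun x => ENNReal.ofReal ((1 / (1 + d) + 1 / (1 + d) * l1norm x) ^ (-α))) fun x => ?_)
  · rw [lintegral_add_mul_l1norm_rpow d hα hc hc]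
    exact ENNReal.ofReal_ne_top
  · refine ENNReal.ofReal_le_ofReal ?_
    have h1 := l1norm_nonneg x
    have h2 := l1norm_nonneg (toReal (latticeFloor x))
    have h3 := l1norm_sub_le_toReal_latticeFloor x
    refine Real.rpow_le_rpow_of_nonpos (by positivity) ?_ (by linarith)
    rw [← mul_one_add, one_div, inv_mul_le_iff₀ (by positivity)]
    nlinarith

variable {Ω : Type*} [MeasurableSpace Ω] {P : Measure Ω}
  {ξ : (Fin d → ℤ) → Ω → ℝ}

lemma measure_one_add_cost_lt_le [IsProbabilityMeasure P] (hd : 1 ≤ d) (hα : (d : ℝ) < α) (hmeas : ∀ z, Measurable (ξ z))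
    (hlaw : ∀ z, P.map (ξ z) = paretoMeasure 1 α) {t : ℝ} (ht : 0 < t) (z : Fin d → ℤ) :
    P {ω | 1 + cost d t (l1norm (toReal z)) < ξ z ω} ≤
      ENNReal.ofReal ((1 + 2 * (2 * d * Real.exp 1 * Real.exp t)) ^ α) *
        ENNReal.ofReal ((1 + l1norm (toReal z)) ^ (-α)) := by
  have h0 : (0 : ℝ) < d := by exact_mod_cast hd
  have hα0 : 0 < α := h0.trans hα
  have hN := l1norm_nonneg (toReal z)
  have hle := le_cost hd ht hN
  set N := l1norm (toReal z)
  set C := 2 * d * Real.exp 1 * Real.exp t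
  have hC : 0 < C := by positivity
  have h1 : 0 < 1 + 2 * C := by positivity
  have h2 : 0 < 1 + N := by positivity
  rw [← ENNReal.ofReal_mul (by positivity)]
  have hK : (1 + 2 * C) ^ α * (1 + N) ^ (-α) = ((1 + N) / (1 + 2 * C)) ^ (-α) := by
    rw [Real.div_rpow h2.le h1.le, Real.rpow_neg h1.le, div_inv_eq_mul, mul_comm]
  rw [hK]
  -- For N ≤ 2C the right-hand side is at least 1. For N ≥ 2C the cost is at least N - C, and 1 + N
  -- - C ≥ (1 + N)/(1 + 2C).
  rcases le_total N (2 * C) with h | h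
  · refine prob_le_one.trans ?_
    rw [ENNReal.one_le_ofReal]
    refine Real.one_le_rpow_of_pos_of_le_one_of_nonpos (by positivity) ?_ (by linarith)
    rw [div_le_one h1]; linarith
  · have h3 : (1 + N) / (1 + 2 * C) ≤ 1 + cost d t N := by
      rw [div_le_iff₀ h1]; nlinarith
    have h4 : 1 ≤ (1 + N) / (1 + 2 * C) := by rw [one_le_div h1]; linarith
    have h5 : P {ω | 1 + cost d t N < ξ z ω} =
        P.map (ξ z) (Set.Ioi (1 + cost d t N)) := by
      rw [Measure.map_apply (hmeas z) measurableSet_Ioi]; rfl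
    rw [h5, hlaw z, paretoMeasure_one_Ioi hα0 (h4.trans h3)]
    exact ENNReal.ofReal_le_ofReal
      (Real.rpow_le_rpow_of_nonpos (by positivity) h3 (by linarith))

/-- By Borel–Cantelli only finitely many sites have Ψ > 1, while Ψ(0) = ξ(0) > 1 almost surely. A
maximiser over these sites together with 0 is thus global, and ties have probability zero. -/
theorem ae_existsUnique_isMaximiser [IsProbabilityMeasure P] (hd : 1 ≤ d) (hα : (d : ℝ) < α)
    (hmeas : ∀ z, Measurable (ξ z)) (hindep : iIndepFun ξ P)
    (hlaw : ∀ z, P.map (ξ z) = paretoMeasure 1 α) {t : ℝ} (ht : 0 < t) :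
    ∀ᵐ ω ∂P, ∃! z : Fin d → ℤ, IsMaximiser (fun z => ξ z ω) t z := by
  have h0 : (0 : ℝ) < d := by exact_mod_cast hd
  have hfin : ∀ᵐ ω ∂P, {z | 1 + cost d t (l1norm (toReal z)) < ξ z ω}.Finite := by
    refine ae_finite_setOfPred_mem (s := fun z => {ω | 1 + cost d t (l1norm (toReal z)) < ξ z ω}) ?_
    refine ne_top_of_le_ne_top ?_
      (ENNReal.tsum_le_tsum fun z => measure_one_add_cost_lt_le hd hα hmeas hlaw ht z)
    rw [ENNReal.tsum_mul_left]
    exact ENNReal.mul_ne_top ENNReal.ofReal_ne_top (tsum_one_add_l1norm_rpow_ne_top hα)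
  have hzero : ∀ᵐ ω ∂P, 1 < ξ 0 ω := by
    have := isProbabilityMeasure_paretoMeasure one_pos (h0.trans hα)
    have h1 : P (ξ 0 ⁻¹' Set.Iic 1) = 0 := by
      rw [← Measure.map_apply (hmeas 0) measurableSet_Iic, hlaw 0, ← Set.compl_Ioi,
        prob_compl_eq_one_sub measurableSet_Ioi, paretoMeasure_one_Ioi (h0.trans hα) le_rfl]
      simp
    rw [ae_iff]
    refine (congrArg P ?_).trans h1
    ext ω; simp
  have hties : ∀ᵐ ω ∂P, ∀ v : (Fin d → ℤ) × (Fin d → ℤ), v.1 ≠ v.2 →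
      Psi (fun z => ξ z ω) t v.1 ≠ Psi (fun z => ξ z ω) t v.2 := by
    refine ae_all_iff.2 fun v => ?_
    by_cases hv : v.1 = v.2
    · exact ae_of_all _ fun ω h => absurd hv h
    · filter_upwards [ae_sub_ne_sub hmeas hindep hlaw (fun z => cost d t (l1norm (toReal z))) hv]
        with ω hω _ using hω
  filter_upwards [hfin, hzero, hties] with ω h1 h2 h3
  obtain ⟨z, hz, hmax⟩ := (h1.insert 0).exists_maximalFor (Psi (fun z => ξ z ω) t) _
    (Set.insert_nonempty _ _)
  have hm : ∀ z' ∈ insert 0 {z | 1 + cost d t (l1norm (toReal z)) < ξ z ω},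
      Psi (fun z => ξ z ω) t z' ≤ Psi (fun z => ξ z ω) t z := fun z' hz' =>
    (le_total _ _).elim id (hmax hz')
  have hP0 : Psi (fun z => ξ z ω) t 0 = ξ 0 ω := by simp [Psi, l1norm, toReal]
  have hall : ∀ z', Psi (fun z => ξ z ω) t z' ≤ Psi (fun z => ξ z ω) t z := by
    intro z'
    by_cases hz' : z' ∈ insert 0 {z | 1 + cost d t (l1norm (toReal z)) < ξ z ω}
    · exact hm z' hz'
    · have h4 : ¬ (1 + cost d t (l1norm (toReal z')) < ξ z' ω) := fun h =>
        hz' (Set.mem_insert_of_mem _ h)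
      have h5 := hm 0 (Set.mem_insert _ _)
      rw [hP0] at h5
      rw [Psi_eq]
      linarith
  refine ⟨z, hall, fun z' hz' => ?_⟩
  by_contra hne
  exact h3 (z', z) hne (le_antisymm (hall z') (hz' z))

lemma measurable_Psi (hmeas : ∀ z, Measurable (ξ z)) (t : ℝ) (z : Fin d → ℤ) :
    Measurable fun ω => Psi (fun z => ξ z ω) t z :=
  (hmeas z).sub_const _

lemma measurableSet_isMaximiser (hmeas : ∀ z, Measurable (ξ z)) (t : ℝ) (z : Fin d → ℤ) :
    MeasurableSet {ω | IsMaximiser (fun z => ξ z ω) t z} := by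
  have : {ω | IsMaximiser (fun z => ξ z ω) t z} =
      ⋂ z', {ω | Psi (fun z => ξ z ω) t z' ≤ Psi (fun z => ξ z ω) t z} := by
    ext; simp [IsMaximiser]
  rw [this]
  exact MeasurableSet.iInter fun z' =>
    measurableSet_le (measurable_Psi hmeas t z') (measurable_Psi hmeas t z)

lemma preimage_singleton_ae_eq {t : ℝ}
    (huniq : ∀ᵐ ω ∂P, ∃! z : Fin d → ℤ, IsMaximiser (fun z => ξ z ω) t z) {Z : Ω → (Fin d → ℤ)}
    (hZ : ∀ᵐ ω ∂P, IsMaximiser (fun z => ξ z ω) t (Z ω)) (z : Fin d → ℤ) :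
    Z ⁻¹' {z} =ᵐ[P] {ω | IsMaximiser (fun z => ξ z ω) t z} := by
  rw [eventuallyEq_set]
  filter_upwards [huniq, hZ] with ω h1 h2
  exact ⟨fun h => by rw [Set.mem_preimage, Set.mem_singleton_iff] at h; rw [← h]; exact h2,
    fun h => h1.unique h2 h⟩

/-- Measurability of Z is not assumed: up to a null set, each fibre of Z is the measurable event
that the given site is a maximiser. -/
lemma aemeasurable_maximiser (hmeas : ∀ z, Measurable (ξ z)) {t : ℝ}
    (huniq : ∀ᵐ ω ∂P, ∃! z : Fin d → ℤ, IsMaximiser (fun z => ξ z ω) t z) {Z : Ω → (Fin d → ℤ)}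
    (hZ : ∀ᵐ ω ∂P, IsMaximiser (fun z => ξ z ω) t (Z ω)) : AEMeasurable Z P := by
  refine NullMeasurable.aemeasurable fun s _ => ?_
  rw [← Set.biUnion_of_singleton s, Set.preimage_iUnion₂]
  exact NullMeasurableSet.biUnion s.to_countable fun z _ =>
    (measurableSet_isMaximiser hmeas t z).nullMeasurableSet.congr
      (preimage_singleton_ae_eq huniq hZ z).symm

lemma aemeasurable_rescaled_pair (hmeas : ∀ z, Measurable (ξ z)) {t : ℝ} {Z : Ω → (Fin d → ℤ)}
    (hZ : AEMeasurable Z P) (ε s : ℝ) :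
    AEMeasurable (fun ω => (ε • toReal (Z ω), s * Psi (fun z => ξ z ω) t (Z ω))) P := by
  have h1 : Measurable fun z : Fin d → ℤ => ε • toReal z := measurable_of_countable _
  have h2 : Measurable fun v : Ω × (Fin d → ℤ) => Psi (fun z => ξ z v.1) t v.2 :=
    measurable_from_prod_countable_left fun z => measurable_Psi hmeas t z
  exact (h1.comp_aemeasurable hZ).prodMk
    ((h2.comp_aemeasurable (aemeasurable_id.prodMk hZ)).const_mul s)

end Maximiser

/-! ### Lower bound for open sets by Fatou's lemma -/

section Limit

variable {d : ℕ} {α : ℝ} {Ω : Type*} [MeasurableSpace Ω] {P : Measure Ω}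
  {ξ : (Fin d → ℤ) → Ω → ℝ}

/-- The value scale `(t / log t)^q`. -/
def scale (d : ℕ) (α t : ℝ) : ℝ := ((Real.log t / t) ^ q d α)⁻¹

lemma scale_pos {t : ℝ} (ht : 1 < t) : 0 < scale d α t :=
  inv_pos.2 (Real.rpow_pos_of_pos (div_pos (Real.log_pos ht) (by linarith)) _)

lemma scale_mul_add {t : ℝ} (ht : 1 < t) (y c : ℝ) :
    scale d α t * (y + (Real.log t / t) ^ q d α * c) = scale d α t * y + c := by
  have := (Real.rpow_pos_of_pos (div_pos (Real.log_pos ht) (by linarith)) (q d α)).ne'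
  rw [mul_add, scale, inv_mul_cancel_left₀ this]

lemma tendsto_scale (hd : 1 ≤ d) (hα : (d : ℝ) < α) : Tendsto (scale d α) atTop atTop :=
  (tendsto_log_div_self_rpow (q_pos hd hα)).inv_tendsto_nhdsGT_zero

lemma scale_rpow_neg {t : ℝ} (ht : 1 < t) :
    scale d α t ^ (-α) = (Real.log t / t) ^ (q d α * α) := by
  have hs : 0 < Real.log t / t := div_pos (Real.log_pos ht) (by linarith)
  rw [scale, ← Real.rpow_neg hs.le, ← Real.rpow_mul hs.le, neg_mul_neg]

/-- The probability that the maximum of `Ψ_t` is at most `u`. -/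
def maxCDF (P : Measure Ω) (ξ : (Fin d → ℤ) → Ω → ℝ) (t u : ℝ) : ℝ≥0∞ :=
  P {ω | ∀ z, ξ z ω ≤ u + cost d t (l1norm (toReal z))}

lemma measurable_maxCDF (t : ℝ) : Measurable (maxCDF P ξ t) :=
  measurable_measure_forall_le fun z => cost d t (l1norm (toReal z))

/-- All thresholds are at least scale·y/2, so every individual tail is at most a common δ → 0. The
infinite product is then at least exp(-sum/(1-δ)), and the sum converges. A convergent minorant `L`
suffices for a liminf bound. -/
lemma exists_tendsto_le_maxCDF [IsProbabilityMeasure P] (hd : 1 ≤ d) (hα : (d : ℝ) < α) 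
    (hmeas : ∀ z, Measurable (ξ z))
    (hindep : iIndepFun ξ P) (hlaw : ∀ z, P.map (ξ z) = paretoMeasure 1 α) {y : ℝ} (hy : 0 < y) :
    ∃ L : ℝ → ℝ≥0∞, Tendsto L atTop
      (𝓝 (ENNReal.ofReal (Real.exp (-(mu d α * y ^ ((d : ℝ) - α)))))) ∧
      ∀ᶠ t in atTop, L t ≤ maxCDF P ξ t (scale d α t * y) := by
  have h0 : (0 : ℝ) < d := by exact_mod_cast hd
  have hα0 : 0 < α := h0.trans hα
  have hq := q_pos hd hα
  set S : ℝ → ℝ≥0∞ := fun t => ∑' z : Fin d → ℤ, ENNReal.ofReal ((Real.log t / t) ^ (q d α * α) *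
    (y + (Real.log t / t) ^ q d α * cost d t (l1norm (toReal z))) ^ (-α)) with hS
  set δ : ℝ → ℝ := fun t => (scale d α t * (y / 2)) ^ (-α) with hδ
  have hSlim : Tendsto S atTop (𝓝 (ENNReal.ofReal (mu d α * y ^ ((d : ℝ) - α)))) :=
    tendsto_tsum_rpow_neg hd hα hy
  have hsc : Tendsto (fun t => scale d α t * (y / 2)) atTop atTop :=
    (tendsto_scale hd hα).atTop_mul_const (half_pos hy)
  have hδlim : Tendsto δ atTop (𝓝 0) := (tendsto_rpow_neg_atTop hα0).comp hsc
  have hmu : 0 ≤ mu d α * y ^ ((d : ℝ) - α) :=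
    mul_nonneg (mu_pos hd hα).le (Real.rpow_nonneg hy.le _)
  refine ⟨fun t => ENNReal.ofReal (Real.exp (-((S t).toReal / (1 - δ t)))), ?_, ?_⟩
  · refine (ENNReal.continuous_ofReal.tendsto _).comp (Tendsto.rexp (Tendsto.neg ?_))
    have h1 := ((ENNReal.tendsto_toReal ENNReal.ofReal_ne_top).comp hSlim).div
      (hδlim.const_sub 1) (by norm_num)
    rwa [ENNReal.toReal_ofReal hmu, sub_zero, div_one] at h1
  · filter_upwards [eventually_gt_atTop 1, eventually_le_rescaled_cost hd hα hy,
      hsc.eventually_ge_atTop 1, hδlim.eventually (gt_mem_nhds one_pos),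
      hSlim.eventually (gt_mem_nhds ENNReal.ofReal_lt_top)] with t ht h1 h2 h3 h4
    have ha := scale_pos (d := d) (α := α) ht
    have hs : 0 < Real.log t / t := div_pos (Real.log_pos ht) (by linarith)
    have hlow : ∀ z : Fin d → ℤ,
        y / 2 ≤ y + (Real.log t / t) ^ q d α * cost d t (l1norm (toReal z)) := by
      intro z
      have hN := l1norm_nonneg (toReal z)
      refine le_trans ?_ (h1 _ hN)
      have := Real.rpow_nonneg hs.le (q d α + 1)
      have : 0 ≤ q d α / 2 * ((Real.log t / t) ^ (q d α + 1) * l1norm (toReal z)) := by positivity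
      linarith
    have hb : ∀ z : Fin d → ℤ, scale d α t * (y / 2) ≤
        scale d α t * y + cost d t (l1norm (toReal z)) := by
      intro z
      rw [← scale_mul_add ht]
      exact mul_le_mul_of_nonneg_left (hlow z) ha.le
    have hSeq : S t = ∑' z : Fin d → ℤ,
        ENNReal.ofReal ((scale d α t * y + cost d t (l1norm (toReal z))) ^ (-α)) := by
      refine tsum_congr fun z => ?_
      rw [← scale_mul_add ht, Real.mul_rpow ha.le ((half_pos hy).le.trans (hlow z)),
        scale_rpow_neg ht]
    rw [hSeq] at h4 ⊢
    exact exp_neg_le_measure_forall_le hα0 hmeas hindep hlaw h3 (fun z => h2.trans (hb z))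
      (fun z => Real.rpow_le_rpow_of_nonpos (by positivity) (hb z) (by linarith)) h4.ne

/-- A lower bound for the density of the rescaled pair (smeared over lattice cells), restricted to
the set `G`. -/
def cellDensity (α : ℝ) (P : Measure Ω) (ξ : (Fin d → ℤ) → Ω → ℝ) (G : Set ((Fin d → ℝ) × ℝ))
    (t : ℝ) (z : Fin d → ℤ) (y : ℝ) : ℝ≥0∞ :=
  G.indicator 1 (mesh d α t • toReal z, y) * maxCDF P ξ t (scale d α t * y) *
    (ENNReal.ofReal ((mesh d α t)⁻¹ ^ d * scale d α t) *
      paretoPDF 1 α (scale d α t * y + cost d t (l1norm (toReal z))))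

lemma measurable_cellDensity {G : Set ((Fin d → ℝ) × ℝ)} (hG : MeasurableSet G) (t : ℝ)
    (z : Fin d → ℤ) : Measurable (cellDensity α P ξ G t z) := by
  have h1 := measurable_maxCDF (P := P) (ξ := ξ) t
  have h2 : Measurable (paretoPDF 1 α) := (measurable_paretoPDFReal 1 α).ennreal_ofReal
  have h3 : Measurable fun y : ℝ =>
      G.indicator (1 : (Fin d → ℝ) × ℝ → ℝ≥0∞) (mesh d α t • toReal z, y) :=
    (measurable_one.indicator hG).comp measurable_prodMk_left
  exact (h3.mul (h1.comp (measurable_const_mul _))).mul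
    ((h2.comp ((measurable_const_mul _).add_const _)).const_mul _)

lemma measurable_comp_latticeFloor {f : (Fin d → ℤ) → ℝ → ℝ≥0∞} (hf : ∀ z, Measurable (f z))
    (r : ℝ) : Measurable fun v : (Fin d → ℝ) × ℝ => f (latticeFloor (r • v.1)) v.2 := by
  have h : Measurable fun v : ℝ × (Fin d → ℤ) => f v.2 v.1 :=
    measurable_from_prod_countable_left hf
  have h2 : Measurable fun v : (Fin d → ℝ) × ℝ => latticeFloor (r • v.1) :=
    measurable_latticeFloor.comp ((measurable_const_smul _).comp measurable_fst)
  exact h.comp (measurable_snd.prodMk h2)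

lemma measurable_cellDensity_latticeFloor {G : Set ((Fin d → ℝ) × ℝ)} (hG : MeasurableSet G)
    (t : ℝ) : Measurable fun v : (Fin d → ℝ) × ℝ =>
      cellDensity α P ξ G t (latticeFloor ((mesh d α t)⁻¹ • v.1)) v.2 :=
  measurable_comp_latticeFloor (measurable_cellDensity hG t) _

/-- The integrand is constant in x on each lattice cell, so the integral is a sum over z. Each term
is at most the probability that z is the maximiser with rescaled pair in G, and these events are
almost surely disjoint. -/
lemma lintegral_cellDensity_le [IsProbabilityMeasure P] (hmeas : ∀ z, Measurable (ξ z)) (hindep : iIndepFun ξ P)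
    (hlaw : ∀ z, P.map (ξ z) = paretoMeasure 1 α) {t : ℝ} (ht : 1 < t)
    (huniq : ∀ᵐ ω ∂P, ∃! z : Fin d → ℤ, IsMaximiser (fun z => ξ z ω) t z)
    {Z : Ω → (Fin d → ℤ)} (hZ : ∀ᵐ ω ∂P, IsMaximiser (fun z => ξ z ω) t (Z ω))
    {G : Set ((Fin d → ℝ) × ℝ)} (hG : MeasurableSet G) :
    ∫⁻ v : (Fin d → ℝ) × ℝ, cellDensity α P ξ G t (latticeFloor ((mesh d α t)⁻¹ • v.1)) v.2 ≤
      P.map (fun ω => ((Real.log t / t) ^ (q d α + 1) • toReal (Z ω),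
        (Real.log t / t) ^ q d α * Psi (fun z => ξ z ω) t (Z ω))) G := by
  have ha := scale_pos (d := d) (α := α) ht
  have hr := inv_pos.2 (mesh_pos (d := d) (α := α) ht)
  have hsa : (Real.log t / t) ^ q d α * scale d α t = 1 :=
    mul_inv_cancel₀ (Real.rpow_pos_of_pos (div_pos (Real.log_pos ht) (by linarith)) _).ne'
  set B : (Fin d → ℤ) → Set ℝ := fun z =>
    {u | (mesh d α t • toReal z, (Real.log t / t) ^ q d α * u) ∈ G} with hB
  have hBm : ∀ z, MeasurableSet (B z) := fun z =>
    (measurable_const.prodMk (measurable_const_mul _)) hG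
  set D : (Fin d → ℤ) → Set Ω := fun z => {ω | Psi (fun z => ξ z ω) t z ∈ B z ∧
    IsMaximiser (fun z => ξ z ω) t z} with hD
  have hDm : ∀ z, MeasurableSet (D z) := fun z =>
    (measurable_Psi hmeas t z (hBm z)).inter (measurableSet_isMaximiser hmeas t z)
  have hcell : ∀ z, ENNReal.ofReal ((mesh d α t)⁻¹ ^ d)⁻¹ * ∫⁻ y, cellDensity α P ξ G t z y ≤
      P (D z) := by
    intro z
    refine le_trans (le_of_eq ?_) (lintegral_paretoPDF_le_measure_isMax hmeas hindep hlaw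
      (fun z => cost d t (l1norm (toReal z))) z (hBm z) ha)
    rw [← lintegral_const_mul' _ _ ENNReal.ofReal_ne_top,
      ← lintegral_const_mul' _ _ ENNReal.ofReal_ne_top]
    refine lintegral_congr fun y => ?_
    have h1 : (B z).indicator (1 : ℝ → ℝ≥0∞) (scale d α t * y) =
        G.indicator 1 (mesh d α t • toReal z, y) := by
      have : scale d α t * y ∈ B z ↔ (mesh d α t • toReal z, y) ∈ G := by
        simp only [hB, Set.mem_ofPred_eq, ← mul_assoc, hsa, one_mul]
      by_cases h : (mesh d α t • toReal z, y) ∈ G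
      · rw [Set.indicator_of_mem h, Set.indicator_of_mem (this.2 h)]; rfl
      · rw [Set.indicator_of_notMem h, Set.indicator_of_notMem (mt this.1 h)]
    have h2 : ENNReal.ofReal ((mesh d α t)⁻¹ ^ d * scale d α t) =
        ENNReal.ofReal ((mesh d α t)⁻¹ ^ d) * ENNReal.ofReal (scale d α t) :=
      ENNReal.ofReal_mul (by positivity)
    have h3 : ENNReal.ofReal ((mesh d α t)⁻¹ ^ d)⁻¹ * ENNReal.ofReal ((mesh d α t)⁻¹ ^ d) = 1 := by
      rw [← ENNReal.ofReal_mul (by positivity), inv_mul_cancel₀ (by positivity),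
        ENNReal.ofReal_one]
    rw [h1, cellDensity, maxCDF, h2]
    have key : ∀ A A' a f h p : ℝ≥0∞, A * A' = 1 → A * (f * h * (A' * a * p)) = a * (f * h * p) := by
      intro A A' a f h p hA
      rw [show A * (f * h * (A' * a * p)) = A * A' * (a * (f * h * p)) by ring, hA, one_mul]
    exact key _ _ _ _ _ _ h3
  have hmap := aemeasurable_rescaled_pair hmeas (aemeasurable_maximiser hmeas huniq hZ)
    ((Real.log t / t) ^ (q d α + 1)) ((Real.log t / t) ^ q d α) (t := t)
  calc ∫⁻ v : (Fin d → ℝ) × ℝ, cellDensity α P ξ G t (latticeFloor ((mesh d α t)⁻¹ • v.1)) v.2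
      = ∫⁻ x : Fin d → ℝ, ∫⁻ y, cellDensity α P ξ G t (latticeFloor ((mesh d α t)⁻¹ • x)) y := by
        rw [Measure.volume_eq_prod,
          lintegral_prod _ (measurable_cellDensity_latticeFloor hG t).aemeasurable]
    _ = ENNReal.ofReal ((mesh d α t)⁻¹ ^ d) * ∫⁻ x : Fin d → ℝ,
          ENNReal.ofReal ((mesh d α t)⁻¹ ^ d)⁻¹ *
            ∫⁻ y, cellDensity α P ξ G t (latticeFloor ((mesh d α t)⁻¹ • x)) y := by
        rw [lintegral_const_mul' _ _ ENNReal.ofReal_ne_top, ← mul_assoc,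
          ← ENNReal.ofReal_mul (by positivity), mul_inv_cancel₀ (by positivity),
          ENNReal.ofReal_one, one_mul]
    _ = ∑' z, ENNReal.ofReal ((mesh d α t)⁻¹ ^ d)⁻¹ * ∫⁻ y, cellDensity α P ξ G t z y :=
        (tsum_eq_lintegral_latticeFloor_smul (fun z => ENNReal.ofReal ((mesh d α t)⁻¹ ^ d)⁻¹ *
          ∫⁻ y, cellDensity α P ξ G t z y) hr).symm
    _ ≤ ∑' z, P (D z) := ENNReal.tsum_le_tsum hcell
    _ = P (⋃ z, D z) := by
        refine (measure_iUnion₀ (fun z z' hzz => ?_) fun z => (hDm z).nullMeasurableSet).symm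
        have : ∀ᵐ ω ∂P, ω ∉ D z ∩ D z' := by
          filter_upwards [huniq] with ω hω h
          exact hzz (hω.unique h.1.2 h.2.2)
        exact measure_eq_zero_iff_ae_notMem.2 this
    _ ≤ _ := by
        rw [Measure.map_apply_of_aemeasurable hmap hG]
        refine measure_mono_ae ?_
        filter_upwards [huniq, hZ] with ω h1 h2 h3
        obtain ⟨z, hz⟩ := Set.mem_iUnion.1 h3
        have : Z ω = z := h1.unique h2 hz.2
        change (_, _) ∈ G
        rw [this]
        exact hz.1

/-- Openness of G keeps the discretised point in G eventually, so the indicator becomes 1; the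
remaining factors have the limit density as limiting minorant. -/
lemma le_liminf_cellDensity [IsProbabilityMeasure P] (hd : 1 ≤ d) (hα : (d : ℝ) < α) 
    (hmeas : ∀ z, Measurable (ξ z))
    (hindep : iIndepFun ξ P) (hlaw : ∀ z, P.map (ξ z) = paretoMeasure 1 α)
    {G : Set ((Fin d → ℝ) × ℝ)} (hG : IsOpen G) {v : (Fin d → ℝ) × ℝ} (hv : v ∈ G)
    (hy : 0 < v.2) :
    ENNReal.ofReal (kernelDensity d α v.1 v.2) ≤ liminf (fun t =>
      cellDensity α P ξ G t (latticeFloor ((mesh d α t)⁻¹ • v.1)) v.2) atTop := by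
  obtain ⟨x, y⟩ := v
  simp only at hy ⊢
  have h0 : (0 : ℝ) < d := by exact_mod_cast hd
  have hα0 : 0 < α := h0.trans hα
  have hq := q_pos hd hα
  have hN := l1norm_nonneg x
  obtain ⟨L, hL, hLle⟩ := exists_tendsto_le_maxCDF hd hα hmeas hindep hlaw hy
  have hpos : 0 < y + q d α * l1norm x := by positivity
  have hc := (tendsto_latticeCost hd hα x).const_add y
  have hpdf : Tendsto (fun t => ENNReal.ofReal (α * (y + latticeCost d α t x) ^ (-(α + 1)))) atTop
      (𝓝 (ENNReal.ofReal (α * (y + q d α * l1norm x) ^ (-(α + 1))))) :=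
    (ENNReal.continuous_ofReal.tendsto _).comp
      ((hc.rpow_const (Or.inl hpos.ne')).const_mul α)
  have hlim := ENNReal.Tendsto.mul hL (Or.inr ENNReal.ofReal_ne_top) hpdf
    (Or.inr ENNReal.ofReal_ne_top)
  have hval : ENNReal.ofReal (Real.exp (-(mu d α * y ^ ((d : ℝ) - α)))) *
      ENNReal.ofReal (α * (y + q d α * l1norm x) ^ (-(α + 1))) =
      ENNReal.ofReal (kernelDensity d α x y) := by
    rw [← ENNReal.ofReal_mul (Real.exp_pos _).le, kernelDensity, Real.rpow_neg hpos.le]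
    congr 1; ring
  rw [← hval, ← hlim.liminf_eq]
  refine liminf_le_liminf ?_
  have hdis : ∀ᶠ t in atTop, (discretise (mesh d α t) x, y) ∈ G := by
    have h1 : Tendsto (fun t => (discretise (mesh d α t) x, y)) atTop (𝓝 (x, y)) :=
      ((tendsto_discretise x).comp (tendsto_mesh hd hα)).prodMk_nhds tendsto_const_nhds
    exact h1.eventually (hG.mem_nhds hv)
  filter_upwards [hLle, hdis, eventually_gt_atTop 1,
    ((tendsto_scale hd hα).atTop_mul_pos hpos hc).eventually_ge_atTop 1,
    hc.eventually (lt_mem_nhds hpos)] with t h1 h2 ht h3 h4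
  have hs : 0 < Real.log t / t := div_pos (Real.log_pos ht) (by linarith)
  have ha := scale_pos (d := d) (α := α) ht
  have hr := inv_pos.2 (mesh_pos (d := d) (α := α) ht)
  rw [discretise] at h2
  rw [cellDensity, Set.indicator_of_mem h2, Pi.one_apply, one_mul, ← scale_mul_add ht,
    ← latticeCost, paretoPDF_of_le h3]
  refine mul_le_mul' h1 (le_of_eq ?_)
  rw [← ENNReal.ofReal_mul (by positivity)]
  congr 1
  -- The Jacobian and the scale factor of the Pareto density cancel exactly, not just
  -- asymptotically.
  have h5 : (mesh d α t)⁻¹ ^ d * scale d α t * scale d α t ^ (-(α + 1)) = 1 := by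
    rw [mul_assoc, ← Real.rpow_one_add' ha.le (by simpa using hα0.ne'),
      show 1 + -(α + 1) = -α by ring, scale_rpow_neg ht, mul_comm, rpow_mul_mesh_inv_pow hα ht]
  rw [Real.mul_rpow ha.le h4.le, Real.one_rpow]
  calc _ = (mesh d α t)⁻¹ ^ d * scale d α t * scale d α t ^ (-(α + 1)) *
        (α * (y + latticeCost d α t x) ^ (-(α + 1))) := by rw [h5, one_mul]
    _ = _ := by ring

theorem jointLimitLaw_le_liminf [IsProbabilityMeasure P] (hd : 1 ≤ d) (hα : (d : ℝ) < α) 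
    (hmeas : ∀ z, Measurable (ξ z))
    (hindep : iIndepFun ξ P) (hlaw : ∀ z, P.map (ξ z) = paretoMeasure 1 α)
    {Z : ℝ → Ω → (Fin d → ℤ)}
    (hZ : ∀ t : ℝ, 0 < t → ∀ᵐ ω ∂P, IsMaximiser (fun z => ξ z ω) t (Z t ω))
    {G : Set ((Fin d → ℝ) × ℝ)} (hG : IsOpen G) :
    jointLimitLaw d α G ≤ liminf (fun t : ℝ =>
      P.map (fun ω => ((Real.log t / t) ^ (q d α + 1) • toReal (Z t ω),
        (Real.log t / t) ^ q d α * Psi (fun z => ξ z ω) t (Z t ω))) G) atTop := by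
  have hGm := hG.measurableSet
  rw [jointLimitLaw, withDensity_apply _ hGm, ← lintegral_indicator hGm]
  refine (lintegral_mono fun v => ?_).trans ((lintegral_liminf_le (u := atTop) fun t : ℝ =>
    measurable_cellDensity_latticeFloor (P := P) (ξ := ξ) (α := α) hGm t).trans
      (liminf_le_liminf ?_))
  · by_cases hv : v ∈ G
    · rw [Set.indicator_of_mem hv]
      split_ifs with hy
      · exact le_liminf_cellDensity hd hα hmeas hindep hlaw hG hv hy
      · exact zero_le
    · rw [Set.indicator_of_notMem hv]
      exact zero_le
  · filter_upwards [eventually_gt_atTop 1] with t ht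
    have ht0 : 0 < t := by linarith
    exact lintegral_cellDensity_le hmeas hindep hlaw ht
      (ae_existsUnique_isMaximiser hd hα hmeas hindep hlaw ht0) (hZ t ht0) hGm

end Limit

end ParabolicAnderson

end


theorem theorem1p2 (d : ℕ) (hd : 1 ≤ d) (α : ℝ) (hα : (d : ℝ) < α)
    {Ω : Type*} [MeasurableSpace Ω] (P : Measure Ω) [IsProbabilityMeasure P]
    (ξ : (Fin d → ℤ) → Ω → ℝ) (hmeas : ∀ z, Measurable (ξ z)) (hindep : iIndepFun ξ P)
    (hpareto : ∀ z, ∀ x : ℝ, 1 ≤ x → P {ω | ξ z ω ≤ x} = ENNReal.ofReal (1 - x ^ (-α))) :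
    -- the maximiser of `Ψ_t` exists and is unique, almost surely
    (∀ t : ℝ, 0 < t →
      ∀ᵐ ω ∂P, ∃! z : Fin d → ℤ, ParabolicAnderson.IsMaximiser (fun z => ξ z ω) t z) ∧
    ∀ Z : ℝ → Ω → (Fin d → ℤ),
      (∀ t : ℝ, 0 < t →
        ∀ᵐ ω ∂P, ParabolicAnderson.IsMaximiser (fun z => ξ z ω) t (Z t ω)) →
      -- the limit law of `Z_t`
      (∃ _ : IsProbabilityMeasure (ParabolicAnderson.limitLaw d α),
        TendstoInDistribution
          (fun (t : Set.Ioi (0 : ℝ)) ω =>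
            (Real.log t / t) ^ (ParabolicAnderson.q d α + 1) •
              ParabolicAnderson.toReal (Z t ω))
          atTop (id : (Fin d → ℝ) → (Fin d → ℝ)) (fun _ => P)
          (ParabolicAnderson.limitLaw d α)) ∧
      -- the joint limit law of `Z_t` and the maximum of `Ψ_t`
      (∃ _ : IsProbabilityMeasure (ParabolicAnderson.jointLimitLaw d α),
        TendstoInDistribution
          (fun (t : Set.Ioi (0 : ℝ)) ω =>
            ((Real.log t / t) ^ (ParabolicAnderson.q d α + 1) •
                ParabolicAnderson.toReal (Z t ω),
              (Real.log t / t) ^ ParabolicAnderson.q d α *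
                ParabolicAnderson.Psi (fun z => ξ z ω) t (Z t ω)))
          atTop (id : (Fin d → ℝ) × ℝ → (Fin d → ℝ) × ℝ) (fun _ => P)
          (ParabolicAnderson.jointLimitLaw d α)) ∧
      -- the second marginal of the joint limit law
      (∀ y : ℝ, 0 < y → ParabolicAnderson.jointLimitLaw d α {v | v.2 ≤ y} =
        ENNReal.ofReal (Real.exp (-(ParabolicAnderson.mu d α * y ^ ((d : ℝ) - α))))) := by
  have hα0 : 0 < α := lt_of_le_of_lt (Nat.cast_nonneg d) hα
  have hlaw : ∀ z, P.map (ξ z) = paretoMeasure 1 α := by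
    intro z
    have := Measure.isProbabilityMeasure_map (μ := P) (hmeas z).aemeasurable
    refine ParabolicAnderson.eq_paretoMeasure_one hα0 fun x hx => ?_
    rw [Measure.map_apply (hmeas z) measurableSet_Iic]
    exact hpareto z x hx
  have huniq : ∀ t : ℝ, 0 < t →
      ∀ᵐ ω ∂P, ∃! z : Fin d → ℤ, ParabolicAnderson.IsMaximiser (fun z => ξ z ω) t z := fun t ht =>
    ParabolicAnderson.ae_existsUnique_isMaximiser hd hα hmeas hindep hlaw ht
  refine ⟨huniq, fun Z hZ => ?_⟩
  have hjoint := ParabolicAnderson.isProbabilityMeasure_jointLimitLaw hd hα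
  have hlimit := ParabolicAnderson.isProbabilityMeasure_limitLaw hd hα
  have hconv : TendstoInDistribution
      (fun (t : Set.Ioi (0 : ℝ)) ω =>
        ((Real.log t / t) ^ (ParabolicAnderson.q d α + 1) • ParabolicAnderson.toReal (Z t ω),
          (Real.log t / t) ^ ParabolicAnderson.q d α *
            ParabolicAnderson.Psi (fun z => ξ z ω) t (Z t ω)))
      atTop (id : (Fin d → ℝ) × ℝ → (Fin d → ℝ) × ℝ) (fun _ => P)
      (ParabolicAnderson.jointLimitLaw d α) := by
    refine ⟨fun t => ?_, aemeasurable_id, ?_⟩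
    · exact ParabolicAnderson.aemeasurable_rescaled_pair hmeas
        (ParabolicAnderson.aemeasurable_maximiser hmeas (huniq t t.2) (hZ t t.2)) _ _
    -- Portmanteau: for probability measures the open-set lower bound alone gives weak convergence.
    -- The liminf over ℝ is then transferred to the index set t > 0.
    · refine tendsto_of_forall_isOpen_le_liminf' fun G hG => ?_
      have h := ParabolicAnderson.jointLimitLaw_le_liminf hd hα hmeas hindep hlaw hZ hG
      rw [← map_val_Ioi_atTop (0 : ℝ), ← liminf_comp] at h
      simpa only [ProbabilityMeasure.coe_mk, Measure.map_id, Function.comp_def] using h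
  refine ⟨⟨hlimit, ?_⟩, ⟨hjoint, hconv⟩, fun y hy =>
    ParabolicAnderson.jointLimitLaw_snd_le hd hα hy⟩
  -- The limit of Z_t alone follows by continuous mapping, since the first marginal of the joint law
  -- has density `p`.
  have hfst := hconv.continuous_comp continuous_fst
  refine ⟨hfst.forall_aemeasurable, aemeasurable_id, ?_⟩
  have hid : (ParabolicAnderson.limitLaw d α).map id =
      (ParabolicAnderson.jointLimitLaw d α).map (Prod.fst ∘ id) := by
    rw [Measure.map_id, Function.comp_id, ParabolicAnderson.map_fst_jointLimitLaw hd hα]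
  simp only [hid]
  exact hfst.tendsto
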